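/- Let $m,n\ge 1$ and $s$ be integers such that $s^m\equiv 1 \pmod n$ and such that $s$ has multiplicative order exactly $m$ modulo $q$ for every prime divisor $q$ of $n$. Let $$G=G^\star_{m,n}=\langle x,y \mid x^m=y^n=1,\ x^{-1}yx=y^s\rangle ,$$ and let $G_{2,3}=\langle x,y\mid x^2=y^3=1,\ x^{-1}yx=y^2\rangle$. A sequence over $G$ is a finite unordered sequence of elements of $G$ with repetition allowed (a multiset); $\boldsymbol\cdot$ denotes concatenation of sequences and $g^{[k]}$ the sequence consisting of $k$ copies of $g$. A sequence $S$ is product-one free if no nonempty subsequence of $S$ has terms whose product, taken in some order, equals $1$. Let $S$ be a sequence over $G$ of length $|S|=m+n-2$. (a) If $G\not\cong G_{2,3}$, then $S$ is product-one free if and only if $$S=(x^ay^{b_1})\boldsymbol\cdot\ldots\boldsymbol\cdot(x^ay^{b_{m-1}})\boldsymbol\cdot(y^c)^{[n-1]}$$ for some $a,c,b_1,\dots,b_{m-1}\in\mathbb N$ with $\gcd(a,m)=\gcd(c,n)=1$. (b) If $G\cong G_{2,3}$, then $S$ is product-one free if and only if either $S=x\boldsymbol\cdot xy\boldsymbol\cdot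 xy^2$, or $S=xy^b\boldsymbol\cdot(y^c)^{[2]}$ for some integers $b\in[0,2]$ and $c\in[1,2]$. -/

import Mathlib

/-- The defining relators `x ^ m`, `y ^ n` and `(x⁻¹ y x) (y ^ s)⁻¹` in the free group on
the two letters `x = of 0` and `y = of 1`. -/
def metacyclicRels (m n : ℕ) (s : ℤ) : Set (FreeGroup (Fin 2)) :=
  {FreeGroup.of 0 ^ m, FreeGroup.of 1 ^ n,
    (FreeGroup.of 0)⁻¹ * FreeGroup.of 1 * FreeGroup.of 0 * (FreeGroup.of 1 ^ s)⁻¹}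

/-- The group `⟨x, y | x ^ m = y ^ n = 1, x⁻¹ y x = y ^ s⟩`. -/
abbrev Metacyclic (m n : ℕ) (s : ℤ) : Type :=
  PresentedGroup (metacyclicRels m n s)

/-- The generator `x`. -/
def Metacyclic.x (m n : ℕ) (s : ℤ) : Metacyclic m n s :=
  PresentedGroup.of 0

/-- The generator `y`. -/
def Metacyclic.y (m n : ℕ) (s : ℤ) : Metacyclic m n s :=
  PresentedGroup.of 1

/-- The set of products `π(S)` of a sequence `S` (a finite unordered sequence with repetition,
that is, a multiset): all products of the terms of `S`, in every order. -/
def productSet {G : Type*} [Group G] (S : Multiset G) : Set G :=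
  {g | ∃ l : List G, (l : Multiset G) = S ∧ l.prod = g}

/-- `S` is product-one free: no nonempty subsequence of `S` has its terms multiply to `1`
in some order. -/
def ProductOneFree {G : Type*} [Group G] (S : Multiset G) : Prop :=
  ∀ T : Multiset G, T ≤ S → T ≠ 0 → (1 : G) ∉ productSet T

/-! The subgroup `⟨y⟩` is cyclic of order `n`, with quotient `ZMod m` through the degree in `x`. The
condition on the order of `s` modulo every prime divisor of `n` makes each nonzero degree act on
`⟨y⟩` without nontrivial fixed points; `CyclicFrobenius` records exactly this.

Rotating a product that lies in the kernel `⟨y⟩` conjugates it by a prefix, so rotations at prefixes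
of different degrees give different kernel elements. Hence a product-one free sequence `W` of total
degree zero produces at least `|W|` nontrivial kernel elements (`card_lt_card_kernelProducts`).
Scherk's theorem adds such counts over disjoint parts, and the kernel has only `n` elements. So if
`|S| = m + n - 2`, a part `U` whose complement has degree zero has at most `|U| - m + 2` kernel
products, the empty one included (`card_kernelProducts_add_le`).

Write `S = R + W` with `R` zero-sum free in degree and `W` of degree zero. The bound forces `|R| = m
- 1`, so all terms of `R` share one generating degree `a`. A term of `W` of degree other than `0`
and `a` would force more than `m - 1` equal terms outside the kernel, whose `m`-th power is `1`
(`deg_eq_zero_or_eq`). If `W` lies in the kernel, it is a zero-sum free sequence of length `n - 1`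
over `ZMod n`, hence constant: the standard form.

Otherwise `S` contains `2 * m - 1` terms of degree `a` with at most `m + 1` kernel products. For `m
≥ 3` they can be paired into distinct elements, and choosing one factor from each pair yields too
many products (`lt_card_kernelProducts_of_pairs`). For `m = 2` the kernel is inverted and only three
reflections with `n = 3` survive, which is the exceptional case. -/

open scoped Pointwise in
/-- Scherk's theorem. -/
theorem Finset.card_add_card_le_card_add_of_unique_zero {Z : Type*} [AddCommGroup Z] [DecidableEq Z]
    (A B : Finset Z) (hA : 0 ∈ A) (hB : 0 ∈ B)
    (h : ∀ a ∈ A, ∀ b ∈ B, a + b = 0 → a = 0 ∧ b = 0) :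
    A.card + B.card ≤ (A + B).card + 1 := by
  induction hk : B.card using Nat.strong_induction_on generalizing A B with
  | _ k ih =>
  subst hk
  by_cases hB1 : B ⊆ {0}
  · have : B = {0} := Finset.Subset.antisymm hB1 (by simpa using hB)
    subst this
    simp
  · obtain ⟨b, hb, hb0⟩ : ∃ b ∈ B, b ≠ 0 := by
      by_contra! hc
      exact hB1 fun b hb => by simpa using hc b hb
    -- Otherwise `A` is stable under translation by `b`, so `0 = a + b` for some `a ∈ A`, against
    -- uniqueness since `b ≠ 0`.
    obtain ⟨a, ha, hab⟩ : ∃ a ∈ A, a + b ∉ A := by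
      by_contra! hc
      have hsub : A.image (· + b) = A := by
        apply Finset.eq_of_subset_of_card_le
        · intro z hz
          obtain ⟨a, ha, rfl⟩ := Finset.mem_image.1 hz
          exact hc a ha
        · rw [Finset.card_image_of_injective _ (add_left_injective b)]
      obtain ⟨a, ha, hab⟩ := Finset.mem_image.1 (hsub.symm ▸ hA : (0 : Z) ∈ A.image (· + b))
      exact hb0 (h a ha b hb hab).2
    -- Dyson transform: the total size is kept, the sumset does not grow, `0` keeps its unique
    -- representation, and `B` loses `b`.
    set A' := A ∪ B.image (a + ·) with hA'
    set B' := B.filter (fun z => a + z ∈ A) with hB'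
    have hlt : B'.card < B.card := by
      apply Finset.card_lt_card
      refine Finset.filter_ssubset.2 ⟨b, hb, hab⟩
    have hsub : A' + B' ⊆ A + B := by
      intro z hz
      obtain ⟨c, hc, d, hd, rfl⟩ := Finset.mem_add.1 hz
      obtain ⟨hd1, hd2⟩ := Finset.mem_filter.1 hd
      rcases Finset.mem_union.1 hc with hc | hc
      · exact Finset.add_mem_add hc hd1
      · obtain ⟨e, he, rfl⟩ := Finset.mem_image.1 hc
        have := Finset.add_mem_add hd2 he
        convert this using 1
        abel
    have hcard : A'.card + B'.card = A.card + B.card := by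
      have h1 : (A ∩ B.image (a + ·)) = B'.image (a + ·) := by
        ext z
        simp only [Finset.mem_inter, Finset.mem_image, hB', Finset.mem_filter]
        constructor
        · rintro ⟨hz, e, he, rfl⟩
          exact ⟨e, ⟨he, hz⟩, rfl⟩
        · rintro ⟨e, ⟨he, hz⟩, rfl⟩
          exact ⟨hz, e, he, rfl⟩
      have h2 := Finset.card_union_add_card_inter A (B.image (a + ·))
      rw [h1, Finset.card_image_of_injective _ (add_right_injective a),
        Finset.card_image_of_injective _ (add_right_injective a)] at h2
      exact h2
    have := ih B'.card hlt A' B' (Finset.mem_union_left _ hA)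
      (Finset.mem_filter.2 ⟨hB, by simpa using ha⟩) ?_ rfl
    · have := Finset.card_le_card hsub
      omega
    · intro c hc d hd hcd
      obtain ⟨hd1, hd2⟩ := Finset.mem_filter.1 hd
      rcases Finset.mem_union.1 hc with hc | hc
      · exact h c hc d hd1 hcd
      · obtain ⟨e, he, rfl⟩ := Finset.mem_image.1 hc
        obtain ⟨h1, h2⟩ := h _ hd2 e he (by rw [← hcd]; abel)
        obtain ⟨h3, h4⟩ := h a ha d hd1 h1
        simp [h2, h3, h4]

theorem Multiset.exists_add_of_le_card {α : Type*} (U : Multiset α) {k : ℕ} (hk : k ≤ U.card) :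
    ∃ T V : Multiset α, U = T + V ∧ T.card = k := by
  induction U using Quotient.inductionOn with
  | _ l =>
  refine ⟨(l.take k : List α), (l.drop k : List α), ?_, ?_⟩
  · simp
  · simpa using hk

/-! ### Zero-sum free sequences over finite abelian groups. -/

section ZeroSumFree

variable {α Z : Type*} [AddCommGroup Z]

/-- No nonempty submultiset of `R` has its `f`-values sum to zero. -/
def ZeroSumFree (f : α → Z) (R : Multiset α) : Prop :=
  ∀ T ≤ R, T ≠ 0 → (T.map f).sum ≠ 0

theorem ZeroSumFree.mono {f : α → Z} {R R' : Multiset α} (h : ZeroSumFree f R) (hR : R' ≤ R) :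
    ZeroSumFree f R' :=
  fun T hT => h T (hT.trans hR)

section Subsums

variable [Fintype Z]

open Classical in
/-- The sums of the `f`-values of the submultisets of `R`. -/
noncomputable def subsums (f : α → Z) (R : Multiset α) : Finset Z :=
  Finset.univ.filter fun z => ∃ T ≤ R, (T.map f).sum = z

theorem mem_subsums {f : α → Z} {R : Multiset α} {z : Z} :
    z ∈ subsums f R ↔ ∃ T ≤ R, (T.map f).sum = z := by
  simp [subsums]

theorem zero_mem_subsums (f : α → Z) (R : Multiset α) : 0 ∈ subsums f R :=
  mem_subsums.2 ⟨0, by simp, by simp⟩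

-- Zero-sum freeness says that `0` is represented only by two empty subsums, which is the hypothesis
-- of Scherk's theorem.
open scoped Pointwise in
theorem ZeroSumFree.card_subsums_add {f : α → Z} {R R' : Multiset α}
    (h : ZeroSumFree f (R + R')) :
    (subsums f R).card + (subsums f R').card ≤ (subsums f (R + R')).card + 1 := by
  classical
  refine (Finset.card_add_card_le_card_add_of_unique_zero _ _ (zero_mem_subsums f R)
    (zero_mem_subsums f R') ?_).trans ?_
  · intro a ha b hb hab
    obtain ⟨T, hT, rfl⟩ := mem_subsums.1 ha
    obtain ⟨T', hT', rfl⟩ := mem_subsums.1 hb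
    have h0 : T + T' = 0 := by
      by_contra hne
      exact h (T + T') (add_le_add hT hT') hne (by simpa using hab)
    obtain ⟨rfl, rfl⟩ := add_eq_zero.1 h0
    simp
  · gcongr
    intro z hz
    obtain ⟨a, ha, b, hb, rfl⟩ := Finset.mem_add.1 hz
    obtain ⟨T, hT, rfl⟩ := mem_subsums.1 ha
    obtain ⟨T', hT', rfl⟩ := mem_subsums.1 hb
    exact mem_subsums.2 ⟨T + T', add_le_add hT hT', by simp⟩

theorem ZeroSumFree.card_lt_card_subsums {f : α → Z} {R : Multiset α} (h : ZeroSumFree f R) :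
    R.card + 1 ≤ (subsums f R).card := by
  induction R using Multiset.induction_on with
  | empty => simpa using Finset.card_pos.2 ⟨0, zero_mem_subsums f 0⟩
  | cons a R ih =>
    have h1 := ih (h.mono (Multiset.le_cons_self R a))
    rw [← Multiset.singleton_add] at h ⊢
    have h2 := h.card_subsums_add
    have h3 : f a ≠ 0 := by
      simpa using h {a} (by simp) (by simp)
    have h4 : 1 < (subsums f {a}).card :=
      Finset.one_lt_card.2 ⟨0, zero_mem_subsums _ _, f a,
        mem_subsums.2 ⟨{a}, le_rfl, by simp⟩, h3.symm⟩
    simp only [Multiset.card_add, Multiset.card_singleton]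
    omega

theorem ZeroSumFree.card_lt_card {f : α → Z} {R : Multiset α} (h : ZeroSumFree f R) :
    R.card + 1 ≤ Fintype.card Z :=
  h.card_lt_card_subsums.trans (Finset.card_le_univ _)

/-- Two terms with different values contribute four subsums `0, f a, f b, f a + f b`, one more than
two terms guarantee. At maximal length this exceeds the size of the group. -/
theorem ZeroSumFree.apply_eq_apply {f : α → Z} {R : Multiset α} (h : ZeroSumFree f R)
    (hcard : Fintype.card Z ≤ R.card + 1) {a b : α} (ha : a ∈ R) (hb : b ∈ R) : f a = f b := by
  classical
  by_contra hab
  have hne : a ≠ b := fun e => hab (by rw [e])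
  obtain ⟨R₁, rfl⟩ := Multiset.exists_cons_of_mem ha
  obtain ⟨R', rfl⟩ := Multiset.exists_cons_of_mem
    ((Multiset.mem_cons.1 hb).resolve_left hne.symm)
  have hR : a ::ₘ b ::ₘ R' = {a, b} + R' := by
    simp [← Multiset.singleton_add, add_assoc]
  rw [hR] at h hcard
  have h1 := h.card_subsums_add
  have h2 := (h.mono (Multiset.le_add_left R' {a, b})).card_lt_card_subsums
  have h3 : (4 : ℕ) ≤ (subsums f {a, b}).card := by
    have ha0 : f a ≠ 0 := by simpa using h {a} (by simp) (by simp)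
    have hb0 : f b ≠ 0 := by simpa using h {b} (by simp) (by simp)
    have hab0 : f a + f b ≠ 0 := by
      simpa using h {a, b} (by simp) (by simp)
    have hsub : ({0, f a, f b, f a + f b} : Finset Z) ⊆ subsums f {a, b} := by
      intro z hz
      simp only [Finset.mem_insert, Finset.mem_singleton] at hz
      rw [mem_subsums]
      rcases hz with rfl | rfl | rfl | rfl
      · exact ⟨0, by simp, by simp⟩
      · exact ⟨{a}, by simp, by simp⟩
      · exact ⟨{b}, by simp, by simp⟩
      · exact ⟨{a, b}, le_rfl, by simp⟩
    have hc4 : ({0, f a, f b, f a + f b} : Finset Z).card = 4 := by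
      rw [Finset.card_insert_of_notMem, Finset.card_insert_of_notMem,
        Finset.card_insert_of_notMem, Finset.card_singleton]
      · simpa using ha0
      · simp [hab, hb0]
      · simp [ha0.symm, hb0.symm, hab0.symm]
    exact hc4 ▸ Finset.card_le_card hsub
  have h4 := Finset.card_le_univ (subsums f ({a, b} + R'))
  simp only [Multiset.card_add, Multiset.card_pair] at hcard
  omega

end Subsums

/-- A zero-sum free sequence of length `m - 1` over `ZMod m` is constant, and its value is a
generator. -/
theorem ZeroSumFree.exists_generator {m : ℕ} [NeZero m] {f : α → ZMod m} {R : Multiset α}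
    (h : ZeroSumFree f R) (hcard : m ≤ R.card + 1) :
    R.card + 1 = m ∧ ∃ a : ZMod m, addOrderOf a = m ∧ ∀ r ∈ R, f r = a := by
  have hle := h.card_lt_card
  rw [ZMod.card] at hle
  refine ⟨le_antisymm hle hcard, ?_⟩
  rcases R.empty_or_exists_mem with rfl | ⟨r, hr⟩
  · have : m = 1 := by
      have := NeZero.pos m
      simp at hcard
      omega
    subst this
    exact ⟨0, by simp, by simp⟩
  · have hconst : ∀ r' ∈ R, f r' = f r := fun r' hr' =>
      h.apply_eq_apply (by rw [ZMod.card]; exact hcard) hr' hr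
    refine ⟨f r, ?_, hconst⟩
    have hdvd : addOrderOf (f r) ∣ m := by
      simpa using addOrderOf_dvd_card (x := f r)
    refine le_antisymm (Nat.le_of_dvd (NeZero.pos m) hdvd) ?_
    by_contra hlt
    push Not at hlt
    -- If the common value had order below `m`, that many terms would be available and would sum to
    -- zero.
    obtain ⟨T, V, rfl, hTc⟩ := R.exists_add_of_le_card (k := addOrderOf (f r)) (by omega)
    refine h T (Multiset.le_add_right T V) ?_ ?_
    · rintro rfl
      have := addOrderOf_pos (f r)
      simp at hTc
      omega
    · rw [Multiset.map_congr rfl fun x hx => hconst x (Multiset.mem_add.2 (Or.inl hx)),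
        Multiset.map_const', Multiset.sum_replicate, hTc, addOrderOf_nsmul_eq_zero]

/-- Every multiset splits into a zero-sum part and a zero-sum free part. -/
theorem exists_zeroSum_add_zeroSumFree (f : α → Z) (U : Multiset α) :
    ∃ W R : Multiset α, U = W + R ∧ (W.map f).sum = 0 ∧ ZeroSumFree f R := by
  induction hk : U.card using Nat.strong_induction_on generalizing U with
  | _ k ih =>
  subst hk
  by_cases hU : ZeroSumFree f U
  · exact ⟨0, U, by simp, by simp, hU⟩
  · simp only [ZeroSumFree, not_forall, not_not] at hU
    obtain ⟨T, hT, hT0, hTs⟩ := hU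
    obtain ⟨V, rfl⟩ := Multiset.le_iff_exists_add.1 hT
    have := Multiset.card_pos.2 hT0
    obtain ⟨W, R, rfl, hW, hR⟩ := ih V.card (by simp; omega) V rfl
    exact ⟨T + W, R, by rw [add_assoc], by simp [hTs, hW], hR⟩

end ZeroSumFree

/-! ### Cyclic-by-cyclic groups with fixed-point-free action. -/

/-- A group `G` with a cyclic normal subgroup `rot (ZMod n)`, whose quotient is `ZMod m` (through
the degree map `deg`) and acts on it by multiplication with the values of `char`, without
nontrivial fixed points. -/
structure CyclicFrobenius (G : Type*) [Group G] (m n : ℕ) where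
  deg : G → ZMod m
  rot : ZMod n → G
  char : ZMod m → ZMod n
  deg_mul : ∀ g h, deg (g * h) = deg g + deg h
  rot_add : ∀ t u, rot (t + u) = rot t * rot u
  rot_injective : Function.Injective rot
  deg_eq_zero_iff : ∀ g, deg g = 0 ↔ ∃ t, rot t = g
  char_add : ∀ d e, char (d + e) = char d * char e
  isUnit_char_sub_one : ∀ d, d ≠ 0 → IsUnit (char d - 1)
  char_zero : char 0 = 1
  rot_mul : ∀ t g, rot t * g = g * rot (t * char (deg g))

namespace CyclicFrobenius

variable {G : Type*} [Group G] {m n : ℕ} (F : CyclicFrobenius G m n)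

theorem rot_zero : F.rot 0 = 1 := by
  have h := F.rot_add 0 0
  rw [add_zero] at h
  exact (mul_eq_left.1 h.symm)

theorem rot_eq_one_iff {t : ZMod n} : F.rot t = 1 ↔ t = 0 := by
  rw [← F.rot_zero, F.rot_injective.eq_iff]

theorem deg_rot (t : ZMod n) : F.deg (F.rot t) = 0 :=
  (F.deg_eq_zero_iff _).2 ⟨t, rfl⟩

theorem deg_one : F.deg 1 = 0 := by
  rw [← F.rot_zero, F.deg_rot]

theorem deg_inv (g : G) : F.deg g⁻¹ = -F.deg g := by
  rw [eq_neg_iff_add_eq_zero, ← F.deg_mul, inv_mul_cancel, F.deg_one]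

theorem deg_prod (l : List G) : F.deg l.prod = ((l : Multiset G).map F.deg).sum := by
  induction l with
  | nil => simp [F.deg_one]
  | cons g l ih => simpa [F.deg_mul] using ih

theorem exists_eq_mul_rot {g h : G} (hd : F.deg g = F.deg h) : ∃ t, g = h * F.rot t := by
  obtain ⟨t, ht⟩ := (F.deg_eq_zero_iff (h⁻¹ * g)).1 (by rw [F.deg_mul, F.deg_inv, hd]; simp)
  exact ⟨t, by rw [ht]; group⟩

theorem isUnit_char (d : ZMod m) : IsUnit (F.char d) :=
  IsUnit.of_mul_eq_one (F.char (-d)) (by rw [← F.char_add, add_neg_cancel, F.char_zero])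

theorem eq_zero_of_mul_char_eq {t : ZMod n} {d : ZMod m} (hd : d ≠ 0) (h : t * F.char d = t) :
    t = 0 := by
  have h1 : t * (F.char d - 1) = 0 := by rw [mul_sub, h, mul_one, sub_self]
  exact (F.isUnit_char_sub_one d hd).mul_left_eq_zero.1 h1

/-- The action of `ZMod m` on nonzero kernel elements is free; this is what makes rotations
countable. -/
theorem mul_char_injective {t : ZMod n} (ht : t ≠ 0) :
    Function.Injective fun d => t * F.char d := by
  intro d e h
  by_contra hne
  have h1 : (t * F.char e) * F.char (d - e) = t * F.char e := by
    rw [mul_assoc, ← F.char_add, add_sub_cancel]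
    exact h
  have h2 := F.eq_zero_of_mul_char_eq (sub_ne_zero.2 hne) h1
  exact ht ((F.isUnit_char e).mul_left_eq_zero.1 h2)

theorem char_nsmul (k : ℕ) (d : ZMod m) : F.char (k • d) = F.char d ^ k := by
  induction k with
  | zero => simp [F.char_zero]
  | succ k ih => rw [succ_nsmul, F.char_add, ih, pow_succ]

/-- The power `g ^ m` lies in the kernel and commutes with `g`, so it is a fixed point of a nonzero
degree. -/
theorem pow_eq_one {g : G} (hg : F.deg g ≠ 0) : g ^ m = 1 := by
  have h1 : F.deg (g ^ m) = 0 := by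
    have := F.deg_prod (List.replicate m g)
    simpa using this
  obtain ⟨t, ht⟩ := (F.deg_eq_zero_iff _).1 h1
  have h2 := F.rot_mul t g
  rw [ht, ← pow_succ, pow_succ', ← ht, mul_right_inj, F.rot_injective.eq_iff] at h2
  rw [← ht, F.eq_zero_of_mul_char_eq hg h2.symm, F.rot_zero]

/-- Rotating a list with product in the kernel multiplies its exponent by a character value. -/
theorem prod_rotated {l₁ l₂ : List G} {t : ZMod n} (h : (l₁ ++ l₂).prod = F.rot t) :
    (l₂ ++ l₁).prod = F.rot (t * F.char (F.deg l₁.prod)) := by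
  have h1 := F.rot_mul t l₁.prod
  rw [← h, List.prod_append, mul_assoc, mul_right_inj] at h1
  rw [List.prod_append, h1]

end CyclicFrobenius

theorem ProductOneFree.prod_ne_one {G : Type*} [Group G] {S : Multiset G} (h : ProductOneFree S)
    {l : List G} (hl : (l : Multiset G) ≤ S) (hne : l ≠ []) : l.prod ≠ 1 :=
  fun h1 => h l hl (by simpa using hne) ⟨l, rfl, h1⟩

theorem ProductOneFree.mono {G : Type*} [Group G] {S T : Multiset G} (h : ProductOneFree S)
    (hT : T ≤ S) : ProductOneFree T :=
  fun U hU => h U (hU.trans hT)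

/-! ### Counting the products that fall in the kernel. -/

namespace CyclicFrobenius

variable {G : Type*} [Group G] {m n : ℕ}

theorem ne_zero_of_prod_eq_rot {F : CyclicFrobenius G m n} {U : Multiset G} (h : ProductOneFree U) {l : List G} (hl : (l : Multiset G) ≤ U)
    (hne : l ≠ []) {t : ZMod n} (ht : l.prod = F.rot t) : t ≠ 0 := by
  rintro rfl
  exact h.prod_ne_one hl hne (by rw [ht, F.rot_zero])

variable [NeZero n] (F : CyclicFrobenius G m n)

open Classical in
/-- The exponents of the products of submultisets of `U` that lie in the kernel, including the
empty product. -/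
noncomputable def kernelProducts (U : Multiset G) : Finset (ZMod n) :=
  Finset.univ.filter fun t => ∃ l : List G, (l : Multiset G) ≤ U ∧ l.prod = F.rot t

variable {F} {U V : Multiset G}

theorem mem_kernelProducts {t : ZMod n} :
    t ∈ F.kernelProducts U ↔ ∃ l : List G, (l : Multiset G) ≤ U ∧ l.prod = F.rot t := by
  simp [kernelProducts]

theorem zero_mem_kernelProducts : 0 ∈ F.kernelProducts U :=
  mem_kernelProducts.2 ⟨[], by simp, by simp [F.rot_zero]⟩

theorem card_kernelProducts_pos : 0 < (F.kernelProducts U).card :=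
  Finset.card_pos.2 ⟨0, zero_mem_kernelProducts⟩

theorem card_kernelProducts_le : (F.kernelProducts U).card ≤ n :=
  (Finset.card_le_univ _).trans_eq (ZMod.card n)

theorem kernelProducts_mono (h : U ≤ V) : F.kernelProducts U ⊆ F.kernelProducts V := by
  intro t ht
  obtain ⟨l, hl, hlp⟩ := mem_kernelProducts.1 ht
  exact mem_kernelProducts.2 ⟨l, hl.trans h, hlp⟩

-- Concatenating two lists with kernel products adds exponents, and product-one freeness makes `0`
-- uniquely represented, so Scherk's theorem applies.
open scoped Pointwise in
theorem card_kernelProducts_add (h : ProductOneFree (U + V)) :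
    (F.kernelProducts U).card + (F.kernelProducts V).card ≤
      (F.kernelProducts (U + V)).card + 1 := by
  classical
  have key : ∀ l l' : List G, (l : Multiset G) ≤ U → (l' : Multiset G) ≤ V →
      ((l ++ l' : List G) : Multiset G) ≤ U + V := fun l l' hl hl' => by
    rw [← Multiset.coe_add]
    exact add_le_add hl hl'
  refine (Finset.card_add_card_le_card_add_of_unique_zero _ _ zero_mem_kernelProducts
    zero_mem_kernelProducts ?_).trans ?_
  · intro a ha b hb hab
    obtain ⟨l, hl, hla⟩ := mem_kernelProducts.1 ha
    obtain ⟨l', hl', hlb⟩ := mem_kernelProducts.1 hb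
    have h0 : l ++ l' = [] := by
      by_contra hne
      exact h.prod_ne_one (key l l' hl hl') hne
        (by rw [List.prod_append, hla, hlb, ← F.rot_add, hab, F.rot_zero])
    obtain ⟨rfl, rfl⟩ := List.append_eq_nil_iff.1 h0
    rw [List.prod_nil, eq_comm, F.rot_eq_one_iff] at hla hlb
    exact ⟨hla, hlb⟩
  · gcongr
    intro z hz
    obtain ⟨a, ha, b, hb, rfl⟩ := Finset.mem_add.1 hz
    obtain ⟨l, hl, hla⟩ := mem_kernelProducts.1 ha
    obtain ⟨l', hl', hlb⟩ := mem_kernelProducts.1 hb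
    exact mem_kernelProducts.2 ⟨l ++ l', key l l' hl hl',
      by rw [List.prod_append, hla, hlb, F.rot_add]⟩

theorem mul_char_mem_kernelProducts {l₁ l₂ : List G} (hl : ((l₁ ++ l₂ : List G) : Multiset G) ≤ U)
    {t : ZMod n} (h : (l₁ ++ l₂).prod = F.rot t) :
    t * F.char (F.deg l₁.prod) ∈ F.kernelProducts U := by
  refine mem_kernelProducts.2 ⟨l₂ ++ l₁, ?_, F.prod_rotated h⟩
  rw [← Multiset.coe_add, add_comm, Multiset.coe_add]
  exact hl

/-- A product-one free sequence whose degrees sum to zero has at least as many nonempty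
products in the kernel as it has terms. -/
theorem card_lt_card_kernelProducts {W : Multiset G} (h : ProductOneFree W)
    (hW : (W.map F.deg).sum = 0) : W.card + 1 ≤ (F.kernelProducts W).card := by
  classical
  induction hk : W.card using Nat.strong_induction_on generalizing W with
  | _ k ih =>
  subst hk
  -- A proper part of degree zero lets the counts be added by Scherk; a minimal `W` is treated by
  -- rotating a single product.
  by_cases hmin : ∃ T ≤ W, T ≠ 0 ∧ T ≠ W ∧ (T.map F.deg).sum = 0
  · obtain ⟨T, hT, hT0, hTW, hTs⟩ := hmin
    obtain ⟨V, rfl⟩ := Multiset.le_iff_exists_add.1 hT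
    have hV0 : V ≠ 0 := by
      rintro rfl
      simp at hTW
    have h1 := Multiset.card_pos.2 hT0
    have h2 := Multiset.card_pos.2 hV0
    have h3 := ih T.card (by simp; omega) (h.mono hT) hTs rfl
    have h4 := ih V.card (by simp; omega) (h.mono (Multiset.le_add_left V T))
      (by simpa [hTs] using hW) rfl
    have h5 := card_kernelProducts_add (F := F) h
    simp only [Multiset.card_add]
    omega
  · push Not at hmin
    rcases eq_or_ne W 0 with rfl | hW0
    · simpa using card_kernelProducts_pos
    obtain ⟨l, rfl⟩ := Quot.exists_rep W
    change (l : Multiset G).card + 1 ≤ (F.kernelProducts (l : Multiset G)).card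
    have hl0 : l ≠ [] := by
      rintro rfl
      exact hW0 rfl
    have hd : F.deg l.prod = 0 := by rw [F.deg_prod]; exact hW
    obtain ⟨t, ht⟩ := (F.deg_eq_zero_iff _).1 hd
    have ht0 : t ≠ 0 := ne_zero_of_prod_eq_rot h (le_refl (l : Multiset G)) hl0 ht.symm
    have hsub : insert 0 ((Finset.range l.length).image
        fun i => t * F.char (F.deg (l.take i).prod)) ⊆ F.kernelProducts (l : Multiset G) := by
      intro z hz
      rcases Finset.mem_insert.1 hz with rfl | hz
      · exact zero_mem_kernelProducts
      · obtain ⟨i, -, rfl⟩ := Finset.mem_image.1 hz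
        exact mul_char_mem_kernelProducts (l₁ := l.take i) (l₂ := l.drop i) (by simp) (by simp [ht])
    have hcard : (insert 0 ((Finset.range l.length).image
        fun i => t * F.char (F.deg (l.take i).prod))).card = l.length + 1 := by
      rw [Finset.card_insert_of_notMem, Finset.card_image_of_injOn, Finset.card_range]
      -- Two prefixes of equal degree would enclose a nonempty proper segment of degree zero,
      -- against minimality.
      · have key : ∀ i j, i < j → j < l.length →
            F.deg (l.take i).prod ≠ F.deg (l.take j).prod := by
          intro i j hij hj he
          have hsplit : l.take j = l.take i ++ (l.take j).drop i := by
            conv_lhs => rw [← List.take_append_drop i (l.take j)]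
            rw [List.take_take, min_eq_left hij.le]
          rw [hsplit, List.prod_append, F.deg_mul, left_eq_add, F.deg_prod] at he
          have hle : ((l.take j).drop i).length < l.length := by simp; omega
          refine hmin ((l.take j).drop i) ?_ ?_ ?_ he
          · exact Multiset.coe_le.2 ((List.drop_sublist _ _).trans (List.take_sublist _ _)).subperm
          · intro h0
            have := congrArg Multiset.card h0
            simp at this
            omega
          · intro h0
            have := congrArg Multiset.card h0
            simp only [Multiset.coe_card] at this
            exact hle.ne this
        intro i hi j hj hij
        have hi' : i < l.length := by simpa using hi
        have hj' : j < l.length := by simpa using hj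
        have := F.mul_char_injective ht0 hij
        rcases lt_trichotomy i j with hlt | heq | hlt
        · exact absurd this (key i j hlt hj')
        · exact heq
        · exact absurd this.symm (key j i hlt hi')
      · simp only [Finset.mem_image, not_exists, not_and]
        intro i _ hi
        exact ht0 ((F.isUnit_char _).mul_left_eq_zero.1 hi)
    rw [Multiset.coe_card, ← hcard]
    exact Finset.card_le_card hsub

/-- In an extremal product-one free sequence, a part whose complement has degree zero has few
products in the kernel. -/
theorem card_kernelProducts_add_le (h : ProductOneFree (U + V)) (hV : (V.map F.deg).sum = 0)
    (hcard : (U + V).card + 2 = m + n) : (F.kernelProducts U).card + m ≤ U.card + 2 := by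
  have h1 := card_kernelProducts_add (F := F) h
  have h2 := card_lt_card_kernelProducts (h.mono (Multiset.le_add_left V U)) hV
  have h3 := card_kernelProducts_le (F := F) (U := U + V)
  rw [Multiset.card_add] at hcard
  omega

/-- The empty product alone already forces `|U| ≥ m - 1`, the maximal length of a zero-sum free
sequence over `ZMod m`. -/
theorem exists_generator [NeZero m] (h : ProductOneFree (U + V)) (hV : (V.map F.deg).sum = 0)
    (hcard : (U + V).card + 2 = m + n) (hU : ZeroSumFree F.deg U) :
    U.card + 1 = m ∧ ∃ a : ZMod m, addOrderOf a = m ∧ ∀ g ∈ U, F.deg g = a := by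
  have h1 := card_kernelProducts_add_le h hV hcard
  have h2 := card_kernelProducts_pos (F := F) (U := U)
  exact hU.exists_generator (by omega)

end CyclicFrobenius

/-! ### Only one nonzero degree occurs. -/

theorem exists_eq_nsmul_of_addOrderOf_eq {m : ℕ} [NeZero m] {a : ZMod m} (ha : addOrderOf a = m)
    (d : ZMod m) : ∃ k < m, d = k • a := by
  have htop : AddSubgroup.zmultiples a = ⊤ := by
    rw [← AddSubgroup.card_eq_iff_eq_top, Nat.card_zmultiples, ha, Nat.card_zmod]
  have hd : d ∈ AddSubgroup.zmultiples a := htop ▸ AddSubgroup.mem_top d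
  obtain ⟨k, hk⟩ := mem_zmultiples_iff_mem_range_addOrderOf.1 hd |> Finset.mem_image.1
  exact ⟨k, by simpa [ha] using hk.1, hk.2.symm⟩

theorem Multiset.sum_map_eq_nsmul {α Z : Type*} [AddCommMonoid Z] {f : α → Z} {R : Multiset α}
    {a : Z} (h : ∀ r ∈ R, f r = a) : (R.map f).sum = R.card • a := by
  rw [Multiset.map_congr rfl h, Multiset.map_const', Multiset.sum_replicate]

namespace CyclicFrobenius

variable {G : Type*} [Group G] {m n : ℕ} {F : CyclicFrobenius G m n}

theorem deg_list_prod_eq_nsmul {l : List G} {a : ZMod m} (h : ∀ g ∈ l, F.deg g = a) :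
    F.deg l.prod = l.length • a := by
  rw [F.deg_prod, Multiset.sum_map_eq_nsmul (fun g hg => h g (by simpa using hg)),
    Multiset.coe_card]

theorem count_lt [DecidableEq G] [NeZero m] {U : Multiset G} (hU : ProductOneFree U) {c : G}
    (hc : F.deg c ≠ 0) : U.count c < m := by
  by_contra! hlt
  refine hU.prod_ne_one (l := List.replicate m c) ?_ ?_ ?_
  · rw [Multiset.coe_replicate]
    exact Multiset.le_count_iff_replicate_le.1 hlt
  · simp [NeZero.ne m]
  · rw [List.prod_replicate, F.pow_eq_one hc]

variable [NeZero n]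

/-- The `r + 1` rotations of one product of `r` terms and `g` have prefix degrees `0, a, …, r • a`,
hence distinct nonzero exponents. Together with `0` they exhaust the allowed `r + 2`. -/
theorem kernelProducts_eq_of_card_le {A : Multiset G} {g : G} {a : ZMod m} {r : ℕ}
    (ha : addOrderOf a = m) (hr : r + 1 < m) (hU : ProductOneFree (g ::ₘ A))
    (hA : ∀ c ∈ A, F.deg c = a) (hcard : (F.kernelProducts (g ::ₘ A)).card ≤ r + 2)
    {l : List G} (hl : (l : Multiset G) ≤ A) (hlr : l.length = r) {t : ZMod n}
    (ht : (l ++ [g]).prod = F.rot t) :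
    t ≠ 0 ∧ F.kernelProducts (g ::ₘ A) =
      insert 0 ((Finset.range (r + 1)).image fun j => t * F.char a ^ j) := by
  have hle : ((l ++ [g] : List G) : Multiset G) ≤ g ::ₘ A := by
    rw [← Multiset.coe_add, add_comm, ← Multiset.singleton_add]
    exact add_le_add (by simp) hl
  have ht0 : t ≠ 0 := ne_zero_of_prod_eq_rot hU hle (by simp) ht
  refine ⟨ht0, (Finset.eq_of_subset_of_card_le ?_ ?_).symm⟩
  · intro z hz
    rcases Finset.mem_insert.1 hz with rfl | hz
    · exact zero_mem_kernelProducts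
    · obtain ⟨j, hj, rfl⟩ := Finset.mem_image.1 hz
      have hj' : j < r + 1 := by simpa using hj
      have hdeg : F.deg (l.take j).prod = j • a := by
        rw [deg_list_prod_eq_nsmul fun c hc =>
          hA c (Multiset.mem_of_le hl (by simpa using List.mem_of_mem_take hc))]
        congr 1
        simp
        omega
      rw [← F.char_nsmul, ← hdeg]
      refine mul_char_mem_kernelProducts (l₁ := l.take j) (l₂ := l.drop j ++ [g]) ?_ ?_
      · simpa [← List.append_assoc] using hle
      · simpa [← List.append_assoc] using ht
  · rw [Finset.card_insert_of_notMem, Finset.card_image_of_injOn, Finset.card_range]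
    · exact hcard
    · intro i hi j hj hij
      have hi' : i < r + 1 := by simpa using hi
      have hj' : j < r + 1 := by simpa using hj
      simp only [← F.char_nsmul] at hij
      have h1 := F.mul_char_injective ht0 hij
      exact nsmul_injOn_Iio_addOrderOf (x := a) (by simp; omega) (by simp; omega) h1
    · simp only [Finset.mem_image, not_exists, not_and]
      intro j _ hj
      rw [← F.char_nsmul] at hj
      exact ht0 ((F.isUnit_char _).mul_left_eq_zero.1 hj)

/-- Products using `c` or `c'` both describe the same kernel set as a geometric progression of
length `r + 1 < m`, a proper arc of a free orbit. An arc determines its starting point, so the two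
products agree and `c = c'`. -/
theorem eq_of_card_kernelProducts_le {A : Multiset G} {g c c' : G} {a : ZMod m} {r : ℕ}
    (ha : addOrderOf a = m) (hr0 : 0 < r) (hr : r + 1 < m)
    (hU : ProductOneFree (g ::ₘ c ::ₘ c' ::ₘ A)) (hg : F.deg g + r • a = 0)
    (hA : ∀ d ∈ c ::ₘ c' ::ₘ A, F.deg d = a)
    (hcard : (F.kernelProducts (g ::ₘ c ::ₘ c' ::ₘ A)).card ≤ r + 2)
    (hAr : r ≤ A.card + 1) : c = c' := by
  obtain ⟨T, V, rfl, hT⟩ := A.exists_add_of_le_card (k := r - 1) (by omega)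
  obtain ⟨l, rfl⟩ := Quot.exists_rep T
  change Multiset.card (l : Multiset G) = r - 1 at hT
  change ∀ d ∈ c ::ₘ c' ::ₘ ((l : Multiset G) + V), F.deg d = a at hA
  change ProductOneFree (g ::ₘ c ::ₘ c' ::ₘ ((l : Multiset G) + V)) at hU
  change (F.kernelProducts (g ::ₘ c ::ₘ c' ::ₘ ((l : Multiset G) + V))).card ≤ r + 2 at hcard
  rw [Multiset.coe_card] at hT
  have hdeg : ∀ d, F.deg d = a → F.deg (d :: l ++ [g]).prod = 0 := by
    intro d hd
    rw [List.prod_append, F.deg_mul, deg_list_prod_eq_nsmul (a := a)]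
    · simp only [List.length_cons, hT, List.prod_singleton]
      rw [Nat.sub_add_cancel hr0, add_comm, hg]
    · intro e he
      rcases List.mem_cons.1 he with rfl | he
      · exact hd
      · exact hA e (by simp [he])
  obtain ⟨t, ht⟩ := (F.deg_eq_zero_iff _).1 (hdeg c (hA c (by simp)))
  obtain ⟨t', ht'⟩ := (F.deg_eq_zero_iff _).1 (hdeg c' (hA c' (by simp)))
  obtain ⟨ht0, h1⟩ := kernelProducts_eq_of_card_le ha hr hU hA hcard (l := c :: l)
    (by
      rw [← Multiset.cons_coe]
      exact Multiset.cons_le_cons c ((Multiset.le_add_right _ V).trans (Multiset.le_cons_self _ _)))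
    (by simp; omega) ht.symm
  obtain ⟨ht0', h2⟩ := kernelProducts_eq_of_card_le ha hr hU hA hcard (l := c' :: l)
    (by
      rw [← Multiset.cons_coe]
      exact (Multiset.cons_le_cons c' (Multiset.le_add_right _ V)).trans (Multiset.le_cons_self _ _))
    (by simp; omega) ht'.symm
  rw [h1] at h2
  have hmem : t ∈ (Finset.range (r + 1)).image fun j => t' * F.char a ^ j := by
    have : t ∈ insert 0 ((Finset.range (r + 1)).image fun j => t' * F.char a ^ j) := by
      rw [← h2]
      exact Finset.mem_insert_of_mem (Finset.mem_image.2 ⟨0, by simp, by simp⟩)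
    exact (Finset.mem_insert.1 this).resolve_left ht0
  obtain ⟨i, hi, hti⟩ := Finset.mem_image.1 hmem
  rcases i with _ | i
  · have : t = t' := by simpa using hti.symm
    subst this
    rw [ht] at ht'
    simpa using ht'
  -- If `t` is not the start of the arc of `t'`, its predecessor in that arc lies in the arc of `t`
  -- too, and stepping forward returns to `t` after at most `r + 1 < m` steps.
  · exfalso
    have hne : t' * F.char a ^ i ≠ 0 := by
      rw [← F.char_nsmul]
      exact fun h0 => ht0' ((F.isUnit_char _).mul_left_eq_zero.1 h0)
    have hmem' : t' * F.char a ^ i ∈ (Finset.range (r + 1)).image fun j => t * F.char a ^ j := by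
      have : t' * F.char a ^ i ∈
          insert 0 ((Finset.range (r + 1)).image fun j => t * F.char a ^ j) := by
        rw [h2]
        refine Finset.mem_insert_of_mem (Finset.mem_image.2 ⟨i, ?_, rfl⟩)
        simp at hi ⊢
        omega
      exact (Finset.mem_insert.1 this).resolve_left hne
    obtain ⟨j, hj, htj⟩ := Finset.mem_image.1 hmem'
    have hj' : j < r + 1 := by simpa using hj
    have hfin : t * F.char ((j + 1) • a) = t := by
      rw [F.char_nsmul, pow_succ, ← mul_assoc, htj, mul_assoc, ← pow_succ, hti]
    exact ht0 (F.eq_zero_of_mul_char_eq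
      (nsmul_ne_zero_of_lt_addOrderOf (by omega) (by omega)) hfin)

/-- In an extremal product-one free sequence, every term outside the kernel has the degree of
the terms of a zero-sum free remainder. -/
theorem deg_eq_zero_or_eq [NeZero m] {R W : Multiset G} (h : ProductOneFree (R + W))
    (hW : (W.map F.deg).sum = 0) (hcard : (R + W).card + 2 = m + n) {a : ZMod m}
    (ha : addOrderOf a = m) (hRm : R.card + 1 = m) (hR : ∀ g ∈ R, F.deg g = a) {g : G}
    (hg : g ∈ W) : F.deg g = 0 ∨ F.deg g = a := by
  classical
  by_contra! hne
  obtain ⟨k, hkm, hk⟩ := exists_eq_nsmul_of_addOrderOf_eq ha (F.deg g)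
  have hk0 : k ≠ 0 := by
    rintro rfl
    exact hne.1 (by simpa using hk)
  have hk1 : k ≠ 1 := by
    rintro rfl
    exact hne.2 (by simpa using hk)
  obtain ⟨W₀, rfl⟩ := Multiset.exists_cons_of_mem hg
  obtain ⟨V, Z, rfl, hV, hZ⟩ := exists_zeroSum_add_zeroSumFree F.deg W₀
  -- Since `g` has degree `k • a`, it is completed to degree zero by `m - k` terms of `R`. The
  -- remaining terms then contain a new zero-sum free remainder `R'` of length `m - 1`.
  obtain ⟨R₁, R₂, rfl, hR₁⟩ := R.exists_add_of_le_card (k := m - k) (by omega)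
  rw [Multiset.card_add] at hRm
  obtain ⟨W₁, R', hQ, hW₁, hR'⟩ := exists_zeroSum_add_zeroSumFree F.deg (R₂ + Z)
  have hgr : F.deg g + (m - k) • a = 0 := by
    rw [hk, ← add_nsmul, Nat.add_sub_cancel' hkm.le]
    simp
  have hR₁s : (R₁.map F.deg).sum = (m - k) • a := by
    rw [Multiset.sum_map_eq_nsmul (fun c hc => hR c (by simp [hc])), hR₁]
  have hS : R₁ + R₂ + g ::ₘ (V + Z) = (g ::ₘ (R₁ + R')) + (V + W₁) := by
    have : R₁ + R₂ + g ::ₘ (V + Z) = g ::ₘ (R₁ + V + (R₂ + Z)) := by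
      simp only [← Multiset.singleton_add]
      abel
    rw [this, hQ]
    simp only [← Multiset.singleton_add]
    abel
  have hS' : R₁ + R₂ + g ::ₘ (V + Z) = R' + (g ::ₘ R₁ + (V + W₁)) := by
    rw [hS]
    simp only [← Multiset.singleton_add]
    abel
  obtain ⟨hR'm, a', ha', hR'a⟩ := exists_generator (F := F) (hS' ▸ h)
    (by simpa only [Multiset.map_add, Multiset.map_cons, Multiset.sum_add, Multiset.sum_cons, hV, hW₁,
      hR₁s, add_zero] using hgr) (hS' ▸ hcard) hR'
  -- Were the degrees different, `R'` would avoid `R₂`, hence be all of `Z`, leaving `R₂` of degree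
  -- zero, although it has `k - 1` terms of degree `a` with `0 < k - 1 < m`.
  obtain rfl : a' = a := by
    by_contra hne'
    have hle : R' ≤ Z := by
      have h1 : R' ≤ R₂ + Z := hQ ▸ Multiset.le_add_left R' W₁
      have h2 := Multiset.filter_le_filter (fun c => F.deg c ≠ a) h1
      rw [Multiset.filter_eq_self.2 fun c hc => by rw [hR'a c hc]; exact hne', Multiset.filter_add,
        Multiset.filter_eq_nil.2 fun c hc => by simp [hR c (by simp [hc])], zero_add] at h2
      exact h2.trans (Multiset.filter_le _ _)
    have hZm := hZ.card_lt_card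
    rw [ZMod.card] at hZm
    have hRZ : R' = Z := Multiset.eq_of_le_of_card_le hle (by omega)
    rw [hRZ, add_left_inj] at hQ
    rw [← hQ, Multiset.sum_map_eq_nsmul (a := a) fun c hc => hR c (by simp [hc])] at hW₁
    exact nsmul_ne_zero_of_lt_addOrderOf (by omega) (by omega) hW₁
  have hE := card_kernelProducts_add_le (F := F) (hS ▸ h) (by simp [hV, hW₁]) (hS ▸ hcard)
  have hPOF : ProductOneFree (g ::ₘ (R₁ + R')) :=
    h.mono (by rw [hS]; exact Multiset.le_add_right _ _)
  have hA : ∀ c ∈ R₁ + R', F.deg c = a' := by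
    intro c hc
    rcases Multiset.mem_add.1 hc with hc | hc
    · exact hR c (by simp [hc])
    · exact hR'a c hc
  have hAcard : (R₁ + R').card + 1 = m - k + m := by
    rw [Multiset.card_add]
    omega
  have hall : ∀ c ∈ R₁ + R', ∀ c' ∈ R₁ + R', c = c' := by
    intro c hc c' hc'
    by_contra hcc
    obtain ⟨A₁, hA₁⟩ := Multiset.exists_cons_of_mem hc
    rw [hA₁] at hc'
    obtain ⟨A', rfl⟩ := Multiset.exists_cons_of_mem
      ((Multiset.mem_cons.1 hc').resolve_left (Ne.symm hcc))
    rw [hA₁] at hPOF hE hA hAcard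
    simp only [Multiset.card_cons] at hE hAcard
    exact hcc (eq_of_card_kernelProducts_le ha (r := m - k) (by omega) (by omega) hPOF hgr hA
      (by omega) (by omega))
  obtain ⟨c, hc⟩ := Multiset.card_pos_iff_exists_mem.1 (show 0 < (R₁ + R').card by omega)
  -- All `2 * m - k - 1 ≥ m` terms coincide, which `c ^ m = 1` forbids.
  have hcnt := count_lt (F := F) hPOF (c := c) (by
    rw [hA c hc]
    simpa using nsmul_ne_zero_of_lt_addOrderOf (x := a') (n := 1) (by omega) (by omega))
  have hrep : (R₁ + R').count c = (R₁ + R').card :=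
    Multiset.count_eq_card.2 fun x hx => hall c hc x hx
  have := Multiset.count_le_of_le c (Multiset.le_cons_self (R₁ + R') g)
  omega

end CyclicFrobenius

/-! ### Many terms of one generating degree, for `m ≥ 3`. -/

/-- Greedy: pair a most frequent element with any other one, which preserves the multiplicity bound.
-/
theorem Multiset.exists_pairing {α : Type*} [DecidableEq α] (k : ℕ) (U : Multiset α)
    (hU : U.card = 2 * k + 1) (hcount : ∀ a, U.count a ≤ k + 1) :
    ∃ (L : List (α × α)) (z : α), L.length = k ∧ (∀ p ∈ L, p.1 ≠ p.2) ∧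
      U = z ::ₘ ((L.map Prod.fst : List α) + (L.map Prod.snd : List α) : Multiset α) := by
  induction k generalizing U with
  | zero =>
    obtain ⟨z, rfl⟩ := Multiset.card_eq_one.1 hU
    exact ⟨[], z, rfl, by simp, by simp⟩
  | succ k ih =>
    obtain ⟨p, hp, hmax⟩ := U.toFinset.exists_max_image (fun a => U.count a) (by
      obtain ⟨x, hx⟩ := Multiset.card_pos_iff_exists_mem.1 (show 0 < U.card by omega)
      exact ⟨x, by simpa using hx⟩)
    rw [Multiset.mem_toFinset] at hp
    obtain ⟨q, hq, hqp⟩ : ∃ q ∈ U, q ≠ p := by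
      by_contra! hc
      have h1 : U.count p = U.card := Multiset.count_eq_card.2 fun x hx => (hc x hx).symm
      have h2 := hcount p
      omega
    obtain ⟨U₁, rfl⟩ := Multiset.exists_cons_of_mem hp
    obtain ⟨U', rfl⟩ := Multiset.exists_cons_of_mem ((Multiset.mem_cons.1 hq).resolve_left hqp)
    simp only [Multiset.card_cons] at hU
    obtain ⟨L, z, hL, hne, rfl⟩ := ih U' (by omega) (by
      intro e
      by_cases hep : e = p
      · subst hep
        have := hcount e
        rw [Multiset.count_cons_self] at this
        have := Multiset.count_le_count_cons e q U'
        omega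
      -- If `e` still occurred at least `k + 2` times, the most frequent `p` would remain at least
      -- `k + 1` times, more than the `2 * k + 1` terms left.
      · by_contra! hlt
        have he : e ∈ U' := Multiset.count_pos.1 (by omega)
        have h1 := hmax e (by simp [he])
        have h2 : U'.count e ≤ (p ::ₘ q ::ₘ U').count e :=
          Multiset.count_le_of_le e
            ((Multiset.le_cons_self _ _).trans (Multiset.le_cons_self _ _))
        rw [Multiset.count_cons_self, Multiset.count_cons_of_ne hqp.symm] at h1
        have h3 : U'.count p + U'.count e ≤ U'.card := by
          have h4 := Multiset.count_le_card p (U'.filter (· ≠ e))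
          rw [Multiset.count_filter_of_pos (p := fun x => x ≠ e) (Ne.symm hep)] at h4
          have h5 := Multiset.card_eq_countP_add_countP (· = e) U'
          simp only [← Multiset.countP_eq_card_filter, ne_eq] at h4
          have h6 : U'.count e = U'.countP (· = e) := by
            simp only [Multiset.count, eq_comm]
          omega
        have h7 : (p ::ₘ q ::ₘ U').count e = U'.count e + if e = q then 1 else 0 := by
          rw [Multiset.count_cons_of_ne hep, Multiset.count_cons]
        omega)
    refine ⟨(p, q) :: L, z, by simp [hL], ?_, ?_⟩
    · intro r hr
      rcases List.mem_cons.1 hr with rfl | hr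
      · exact hqp.symm
      · exact hne r hr
    · simp only [List.map_cons, ← Multiset.cons_coe, ← Multiset.singleton_add]
      abel

/-- `l` picks one entry of each of the pairs in `L`. -/
def IsSelection {α : Type*} (l : List α) (L : List (α × α)) : Prop :=
  List.Forall₂ (fun c p => c = p.1 ∨ c = p.2) l L

theorem IsSelection.coe_le {α : Type*} {l : List α} {L : List (α × α)} (h : IsSelection l L) :
    (l : Multiset α) ≤ (L.map Prod.fst : List α) + (L.map Prod.snd : List α) := by
  induction h with
  | nil => simp
  | @cons c p l L hcp _ ih =>
    have h1 : ({c} : Multiset α) ≤ {p.1} + {p.2} := by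
      rcases hcp with rfl | rfl
      · exact Multiset.le_add_right _ _
      · exact Multiset.le_add_left _ _
    have h2 := add_le_add h1 ih
    simp only [List.map_cons, ← Multiset.cons_coe, ← Multiset.singleton_add]
    refine h2.trans_eq ?_
    abel

namespace CyclicFrobenius

variable {G : Type*} [Group G] {m n : ℕ} {F : CyclicFrobenius G m n}

/-- If no nonempty finite subset of `E` is stable under a nontrivial kernel element, then each
pair of distinct factors of the same degree enlarges the set of products inside `E`. -/
theorem exists_large_set_of_products {E : Set G}
    (hE : ∀ X : Finset G, X.Nonempty → ↑X ⊆ E → ∀ t, t ≠ 0 → ¬ ∀ x ∈ X, F.rot t * x ∈ X)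
    {B : Finset G} (hB : B.Nonempty) (L : List (G × G))
    (hL : ∀ q ∈ L, q.1 ≠ q.2 ∧ F.deg q.1 = F.deg q.2) (p : G)
    (hpE : ∀ l, IsSelection l L → ∀ b ∈ B, p * l.prod * b ∈ E) :
    ∃ P : Finset G, L.length + B.card ≤ P.card ∧
      ∀ g ∈ P, ∃ l, IsSelection l L ∧ ∃ b ∈ B, g = l.prod * b := by
  classical
  induction L generalizing p with
  | nil => exact ⟨B, by simp, fun g hg => ⟨[], .nil, g, hg, by simp⟩⟩
  | cons q L ih =>
    obtain ⟨P, hPc, hP⟩ := ih (fun r hr => hL r (List.mem_cons_of_mem q hr)) (p * q.1)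
      (fun l hl b hb => by
        have := hpE (q.1 :: l) (.cons (Or.inl rfl) hl) b hb
        simpa [mul_assoc] using this)
    have hcard : ∀ w : G, (P.image (w * ·)).card = P.card := fun w =>
      Finset.card_image_of_injective _ (mul_right_injective w)
    refine ⟨P.image (q.1 * ·) ∪ P.image (q.2 * ·), ?_, ?_⟩
    · by_contra! hlt
      simp only [List.length_cons] at hlt
      -- No growth means `q.2 * P ⊆ q.1 * P`; then conjugating by the accumulated prefix `p` turns
      -- `q.2 * q.1⁻¹` into a nontrivial kernel element stabilizing `p * q.1 * P`.
      have h1 : P.image (q.1 * ·) = P.image (q.1 * ·) ∪ P.image (q.2 * ·) :=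
        Finset.eq_of_subset_of_card_le Finset.subset_union_left (by rw [hcard]; omega)
      have h2 : P.image (q.2 * ·) ⊆ P.image (q.1 * ·) := by
        rw [h1]
        exact Finset.subset_union_right
      obtain ⟨hne, hdeg⟩ := hL q (by simp)
      obtain ⟨t, ht⟩ := (F.deg_eq_zero_iff (p * q.2 * q.1⁻¹ * p⁻¹)).1 (by
        simp only [F.deg_mul, F.deg_inv, hdeg]
        abel)
      have hPne : P.Nonempty := Finset.card_pos.1 (by have := Finset.card_pos.2 hB; omega)
      refine hE (P.image (p * q.1 * ·)) (hPne.image _) ?_ t ?_ ?_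
      · intro x hx
        obtain ⟨g, hg, rfl⟩ := Finset.mem_image.1 (Finset.mem_coe.1 hx)
        obtain ⟨l, hl, b, hb, rfl⟩ := hP g hg
        have := hpE (q.1 :: l) (.cons (Or.inl rfl) hl) b hb
        simpa [mul_assoc] using this
      · rintro rfl
        rw [F.rot_zero, eq_comm, mul_inv_eq_one, mul_inv_eq_iff_eq_mul, mul_right_inj] at ht
        exact hne ht.symm
      · intro x hx
        obtain ⟨g, hg, rfl⟩ := Finset.mem_image.1 hx
        obtain ⟨g', hg', hgg⟩ := Finset.mem_image.1 (h2 (Finset.mem_image_of_mem _ hg))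
        refine Finset.mem_image.2 ⟨g', hg', ?_⟩
        rw [ht, mul_assoc p, hgg]
        group
    · intro g hg
      rcases Finset.mem_union.1 hg with hg | hg
      · obtain ⟨g', hg', rfl⟩ := Finset.mem_image.1 hg
        obtain ⟨l, hl, b, hb, rfl⟩ := hP g' hg'
        exact ⟨q.1 :: l, .cons (Or.inl rfl) hl, b, hb, by simp [mul_assoc]⟩
      · obtain ⟨g', hg', rfl⟩ := Finset.mem_image.1 hg
        obtain ⟨l, hl, b, hb, rfl⟩ := hP g' hg'
        exact ⟨q.2 :: l, .cons (Or.inr rfl) hl, b, hb, by simp [mul_assoc]⟩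

/-- For two pairs of distinct elements of degree `a`, the four products with a suitable inserted
factor `w` are distinct. -/
theorem four_products_distinct {a : ZMod m} (ha2 : a + a ≠ 0) {u₁ v₁ u₂ v₂ z : G}
    (h₁ : u₁ ≠ v₁) (hu₁ : F.deg u₁ = a) (hv₁ : F.deg v₁ = a) (hu₂ : F.deg u₂ = a)
    (hv₂ : F.deg v₂ = a) (hz : F.deg z = a) :
    ∃ w ∈ ({1, z} : Set G), u₁ * w * u₂ ≠ v₁ * w * v₂ ∧ u₁ * w * v₂ ≠ v₁ * w * u₂ := by
  obtain ⟨d, rfl⟩ := F.exists_eq_mul_rot (hv₁.trans hu₁.symm)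
  obtain ⟨e, rfl⟩ := F.exists_eq_mul_rot (hv₂.trans hu₂.symm)
  have hd : d ≠ 0 := by
    rintro rfl
    exact h₁ (by rw [F.rot_zero, mul_one])
  have key : ∀ w, u₁ * F.rot d * w * u₂ = u₁ * w * u₂ * F.rot (d * F.char (F.deg w + a)) := by
    intro w
    rw [mul_assoc, mul_assoc, F.rot_mul, F.deg_mul, hu₂]
    simp only [mul_assoc]
  have key₁ : ∀ w, u₁ * w * u₂ = u₁ * F.rot d * w * (u₂ * F.rot e) →
      d * F.char (F.deg w + a) = -e := by
    intro w h
    rw [← mul_assoc, key, mul_assoc _ (F.rot _) (F.rot _), ← F.rot_add, left_eq_mul, F.rot_eq_one_iff] at h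
    exact eq_neg_of_add_eq_zero_left h
  have key₂ : ∀ w, u₁ * w * (u₂ * F.rot e) = u₁ * F.rot d * w * u₂ →
      d * F.char (F.deg w + a) = e := by
    intro w h
    rw [← mul_assoc, key, mul_right_inj, F.rot_injective.eq_iff] at h
    exact h.symm
  have key₃ : ∀ w, ¬ (u₁ * w * u₂ ≠ u₁ * F.rot d * w * (u₂ * F.rot e) ∧
      u₁ * w * (u₂ * F.rot e) ≠ u₁ * F.rot d * w * u₂) →
      d * F.char (F.deg w + a) = -e ∨ d * F.char (F.deg w + a) = e := by
    intro w h
    by_contra! hc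
    exact h ⟨fun h' => hc.1 (key₁ w h'), fun h' => hc.2 (key₂ w h')⟩
  by_contra! hc
  -- If both insertions fail, `d * χ(a)` and `d * χ(a) * χ(a)` are both `±e`, so `χ(a)` acts on `d *
  -- χ(a)` by a sign and `χ(a + a)` fixes it, although `a + a ≠ 0`.
  have e₁ := key₃ 1 (fun h => h.2 (hc 1 (by simp) h.1))
  have e₂ := key₃ z (fun h => h.2 (hc z (by simp) h.1))
  rw [F.deg_one, zero_add] at e₁
  rw [hz, F.char_add, ← mul_assoc] at e₂
  have hs : d * F.char a * F.char a = d * F.char a ∨ d * F.char a * F.char a = -(d * F.char a) := by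
    rcases e₁ with e₁ | e₁ <;> rcases e₂ with e₂ | e₂ <;> rw [e₂, e₁] <;> simp
  have hsq : d * F.char a * F.char (a + a) = d * F.char a := by
    rw [F.char_add, ← mul_assoc]
    rcases hs with hs | hs
    · rw [hs, hs]
    · rw [hs, neg_mul, hs, neg_neg]
  exact hd ((F.isUnit_char a).mul_left_eq_zero.1 (F.eq_zero_of_mul_char_eq ha2 hsq))

end CyclicFrobenius

namespace CyclicFrobenius

variable {G : Type*} [Group G] {m n : ℕ} {F : CyclicFrobenius G m n} [NeZero n]

/-- The set of products of `m` terms of `U`, when all these have the same degree and there are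
few of them, has no nonempty subset that is stable under a nontrivial kernel element. -/
theorem not_stable_of_card_kernelProducts_le [NeZero m] {U : Multiset G} (hU : ProductOneFree U)
    {a : ZMod m} (ha : addOrderOf a = m) (hUa : ∀ g ∈ U, F.deg g = a)
    (hcard : (F.kernelProducts U).card ≤ m + 1) (X : Finset G) (hX : X.Nonempty)
    (hXE : ∀ x ∈ X, ∃ l : List G, l.length = m ∧ (l : Multiset G) ≤ U ∧ l.prod = x)
    {t : ZMod n} (ht : t ≠ 0) : ¬ ∀ x ∈ X, F.rot t * x ∈ X := by
  intro hstab
  have hmem : ∀ x ∈ X, ∃ e, e ≠ 0 ∧ e ∈ F.kernelProducts U ∧ x = F.rot e ∧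
      ∀ i < m, e * F.char a ^ i ∈ F.kernelProducts U := by
    intro x hx
    obtain ⟨l, hlm, hlU, rfl⟩ := hXE x hx
    have hla : ∀ g ∈ l, F.deg g = a := fun g hg => hUa g (Multiset.mem_of_le hlU (by simpa using hg))
    obtain ⟨e, he⟩ := (F.deg_eq_zero_iff l.prod).1 (by
      rw [deg_list_prod_eq_nsmul hla, hlm]
      simp)
    refine ⟨e, ne_zero_of_prod_eq_rot hU hlU ?_ he.symm, mem_kernelProducts.2 ⟨l, hlU, he.symm⟩,
      he.symm, ?_⟩
    · rintro rfl
      exact NeZero.ne m hlm.symm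
    · intro i hi
      have h1 := mul_char_mem_kernelProducts (F := F) (l₁ := l.take i) (l₂ := l.drop i) (t := e)
        (by simpa using hlU) (by simpa using he.symm)
      rw [deg_list_prod_eq_nsmul (a := a) fun g hg => hla g (List.mem_of_mem_take hg),
        List.length_take, hlm, min_eq_left hi.le, F.char_nsmul] at h1
      exact h1
  obtain ⟨x, hx⟩ := hX
  obtain ⟨e, he0, -, rfl, heo⟩ := hmem x hx
  -- One product of `m` terms already gives a full orbit of `m` nonzero exponents, so the bound `m +
  -- 1` leaves room for nothing else.
  have horbit : F.kernelProducts U =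
      insert 0 ((Finset.range m).image fun i => e * F.char a ^ i) := by
    refine (Finset.eq_of_subset_of_card_le ?_ ?_).symm
    · intro z hz
      rcases Finset.mem_insert.1 hz with rfl | hz
      · exact zero_mem_kernelProducts
      · obtain ⟨i, hi, rfl⟩ := Finset.mem_image.1 hz
        exact heo i (by simpa using hi)
    · rw [Finset.card_insert_of_notMem, Finset.card_image_of_injOn, Finset.card_range]
      · exact hcard
      · intro i hi j hj hij
        simp only [← F.char_nsmul] at hij
        exact nsmul_injOn_Iio_addOrderOf (x := a) (by simpa [ha] using hi) (by simpa [ha] using hj)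
          (F.mul_char_injective he0 hij)
      · simp only [Finset.mem_image, not_exists, not_and]
        intro j _ hj
        rw [← F.char_nsmul] at hj
        exact he0 ((F.isUnit_char _).mul_left_eq_zero.1 hj)
  have hshift := hstab _ hx
  rw [← F.rot_add] at hshift
  obtain ⟨e', he'0, he'm, he', -⟩ := hmem _ hshift
  obtain rfl := F.rot_injective he'
  rw [horbit] at he'm
  obtain ⟨i, hi, hti⟩ := Finset.mem_image.1 ((Finset.mem_insert.1 he'm).resolve_left he'0)
  rw [← F.char_nsmul] at hti
  have hia : i • a ≠ 0 := by
    intro h0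
    rw [h0, F.char_zero, mul_one, eq_comm, add_eq_right] at hti
    exact ht hti
  -- From `t + e = e * χ(i • a)`, the shift is `t = e * (χ(i • a) - 1)`, a unit multiple of `e`.
  -- Some multiple of `t` therefore carries `e` to `0`, which stability would place in `X`.
  obtain ⟨w, hw⟩ := (F.isUnit_char_sub_one _ hia).exists_right_inv
  have hew : e + (-w) * t = 0 := by
    have : t = e * (F.char (i • a) - 1) := by
      rw [mul_sub, hti]
      ring
    rw [this]
    linear_combination (-e) * hw
  have hiter : ∀ k : ℕ, F.rot (k * t + e) ∈ X := by
    intro k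
    induction k with
    | zero => simpa using hx
    | succ k ih =>
      have := hstab _ ih
      rw [← F.rot_add] at this
      convert this using 2
      push_cast
      ring
  have h0 := hiter (-w).val
  rw [ZMod.natCast_zmod_val, add_comm, hew] at h0
  obtain ⟨e'', he'', -, h1, -⟩ := hmem _ h0
  exact he'' (F.rot_injective h1).symm

/-- Two pairs and `z` supply four distinct products of three terms, and each of the `m - 3` further
pairs enlarges the set. This gives `m + 1` nonzero exponents, and `0` is one more. -/
theorem lt_card_kernelProducts_of_pairs [NeZero m] {a : ZMod m} (ha : addOrderOf a = m)
    (hm : 3 ≤ m) {u₁ v₁ u₂ v₂ z : G} {L : List (G × G)} (hL : L.length + 3 = m)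
    (h₁ : u₁ ≠ v₁) (h₂ : u₂ ≠ v₂) (hne : ∀ q ∈ L, q.1 ≠ q.2)
    (hU : ProductOneFree ((L.map Prod.fst : List G) + (L.map Prod.snd : List G) +
      ([u₁, v₁, u₂, v₂, z] : List G) : Multiset G))
    (hUa : ∀ g ∈ ((L.map Prod.fst : List G) + (L.map Prod.snd : List G) +
      ([u₁, v₁, u₂, v₂, z] : List G) : Multiset G), F.deg g = a) :
    m + 1 < (F.kernelProducts ((L.map Prod.fst : List G) + (L.map Prod.snd : List G) +
      ([u₁, v₁, u₂, v₂, z] : List G) : Multiset G)).card := by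
  classical
  by_contra! hcard
  obtain ⟨B, hB4, hB⟩ : ∃ B : Finset G, B.card = 4 ∧ ∀ b ∈ B, ∃ l : List G, l.length = 3 ∧
      (l : Multiset G) ≤ ([u₁, v₁, u₂, v₂, z] : List G) ∧ l.prod = b := by
    have ha2 : a + a ≠ 0 := by
      rw [← two_nsmul]
      exact nsmul_ne_zero_of_lt_addOrderOf (by omega) (by omega)
    obtain ⟨w, hw, hd₁, hd₂⟩ := four_products_distinct (F := F) ha2 h₁ (u₂ := u₂) (v₂ := v₂)
      (z := z) (hUa _ (by simp)) (hUa _ (by simp)) (hUa _ (by simp)) (hUa _ (by simp))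
      (hUa _ (by simp))
    have hcard4 : ({u₁ * w * u₂, u₁ * w * v₂, v₁ * w * u₂, v₁ * w * v₂} : Finset G).card = 4 := by
      rw [Finset.card_insert_of_notMem, Finset.card_insert_of_notMem,
        Finset.card_insert_of_notMem, Finset.card_singleton]
      · simpa using h₂
      · simp [hd₂, h₁]
      · simp [hd₁, h₁, h₂]
    have hsub : ∀ c ∈ ({u₁, v₁} : Set G), ∀ d ∈ ({u₂, v₂} : Set G),
        ({c, z, d} : Multiset G) ≤ ([u₁, v₁, u₂, v₂, z] : List G) := by
      intro c hc d hd
      have e₁ : ({c} : Multiset G) ≤ {u₁, v₁} := by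
        rcases hc with rfl | rfl <;> simp
      have e₂ : ({d} : Multiset G) ≤ {u₂, v₂} := by
        rcases hd with rfl | rfl <;> simp
      have e₃ := add_le_add (add_le_add e₁ e₂) (le_refl ({z} : Multiset G))
      have e₄ : ({c, z, d} : Multiset G) = {c} + {d} + {z} := by
        simp only [Multiset.insert_eq_cons, ← Multiset.singleton_add]
        abel
      rw [e₄]
      refine e₃.trans_eq ?_
      simp only [Multiset.insert_eq_cons, ← Multiset.cons_coe, ← Multiset.singleton_add,
        Multiset.coe_nil]
      abel
    rcases hw with rfl | rfl
    -- When nothing is inserted in the middle, `z` is appended so that every product still has three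
    -- factors.
    · refine ⟨({u₁ * 1 * u₂, u₁ * 1 * v₂, v₁ * 1 * u₂, v₁ * 1 * v₂} : Finset G).image (· * z), ?_,
        ?_⟩
      · rw [Finset.card_image_of_injective _ (mul_left_injective z), hcard4]
      · intro b hb
        have : ∃ c ∈ ({u₁, v₁} : Set G), ∃ d ∈ ({u₂, v₂} : Set G), [c, d, z].prod = b := by
          simp only [Finset.mem_image, Finset.mem_insert, Finset.mem_singleton] at hb
          obtain ⟨b', rfl | rfl | rfl | rfl, rfl⟩ := hb
          · exact ⟨u₁, by simp, u₂, by simp, by simp [mul_assoc]⟩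
          · exact ⟨u₁, by simp, v₂, by simp, by simp [mul_assoc]⟩
          · exact ⟨v₁, by simp, u₂, by simp, by simp [mul_assoc]⟩
          · exact ⟨v₁, by simp, v₂, by simp, by simp [mul_assoc]⟩
        obtain ⟨c, hc, d, hd, hb⟩ := this
        refine ⟨[c, d, z], rfl, ?_, hb⟩
        refine le_trans (le_of_eq ?_) (hsub c hc d hd)
        exact congrArg (c ::ₘ ·) (Multiset.cons_swap d z 0)
    · refine ⟨_, hcard4, ?_⟩
      intro b hb
      have : ∃ c ∈ ({u₁, v₁} : Set G), ∃ d ∈ ({u₂, v₂} : Set G), [c, w, d].prod = b := by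
        simp only [Finset.mem_insert, Finset.mem_singleton] at hb
        obtain rfl | rfl | rfl | rfl := hb
        · exact ⟨u₁, by simp, u₂, by simp, by simp [mul_assoc]⟩
        · exact ⟨u₁, by simp, v₂, by simp, by simp [mul_assoc]⟩
        · exact ⟨v₁, by simp, u₂, by simp, by simp [mul_assoc]⟩
        · exact ⟨v₁, by simp, v₂, by simp, by simp [mul_assoc]⟩
      obtain ⟨c, hc, d, hd, hb⟩ := this
      exact ⟨[c, w, d], rfl, hsub c hc d hd, hb⟩
  set U : Multiset G := (L.map Prod.fst : List G) + (L.map Prod.snd : List G) +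
      ([u₁, v₁, u₂, v₂, z] : List G) with hUdef
  have hprod : ∀ l, IsSelection l L → ∀ b ∈ B,
      ∃ l' : List G, l'.length = m ∧ (l' : Multiset G) ≤ U ∧ l'.prod = l.prod * b := by
    intro l hl b hb
    obtain ⟨l₃, hl₃, hle, rfl⟩ := hB b hb
    refine ⟨l ++ l₃, ?_, ?_, by simp⟩
    · have := List.Forall₂.length_eq hl
      simp
      omega
    · rw [← Multiset.coe_add]
      exact add_le_add hl.coe_le hle
  obtain ⟨P, hPc, hP⟩ := exists_large_set_of_products (F := F)
    (E := {x | ∃ l' : List G, l'.length = m ∧ (l' : Multiset G) ≤ U ∧ l'.prod = x})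
    (fun X hX hXE t ht => not_stable_of_card_kernelProducts_le hU ha hUa hcard X hX
      (fun x hx => hXE hx) ht)
    (B := B) (Finset.card_pos.1 (by omega)) L
    (fun q hq => ⟨hne q hq, by
      rw [hUa q.1 (by simp [hUdef]; left; exact ⟨q.2, hq⟩),
        hUa q.2 (by simp [hUdef]; right; left; exact ⟨q.1, hq⟩)]⟩) 1
    (by simpa using hprod)
  have hsub : P ⊆ ((F.kernelProducts U).erase 0).image F.rot := by
    intro x hx
    obtain ⟨l, hl, b, hb, rfl⟩ := hP x hx
    obtain ⟨l', hl'm, hl'U, hl'⟩ := hprod l hl b hb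
    rw [← hl']
    obtain ⟨e, he⟩ := (F.deg_eq_zero_iff l'.prod).1 (by
      rw [deg_list_prod_eq_nsmul fun g hg => hUa g (Multiset.mem_of_le hl'U (by simpa using hg)),
        hl'm]
      simp)
    refine Finset.mem_image.2 ⟨e, Finset.mem_erase.2 ⟨?_, mem_kernelProducts.2
      ⟨l', hl'U, he.symm⟩⟩, he⟩
    refine ne_zero_of_prod_eq_rot hU hl'U ?_ he.symm
    rintro rfl
    exact NeZero.ne m hl'm.symm
  have h1 := (Finset.card_le_card hsub).trans Finset.card_image_le
  rw [Finset.card_erase_of_mem zero_mem_kernelProducts] at h1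
  omega

/-- A product-one free sequence of `2 * m - 1` terms of the same generating degree has many
products in the kernel. -/
theorem lt_card_kernelProducts_of_deg_eq [NeZero m] {a : ZMod m} (ha : addOrderOf a = m)
    (hm : 3 ≤ m) {U : Multiset G} (hU : ProductOneFree U) (hUa : ∀ g ∈ U, F.deg g = a)
    (hUc : U.card + 1 = 2 * m) : m + 1 < (F.kernelProducts U).card := by
  classical
  have ha0 : a ≠ 0 := by
    rintro rfl
    rw [addOrderOf_zero] at ha
    omega
  obtain ⟨L, z, hL, hne, rfl⟩ := U.exists_pairing (m - 1) (by omega) (by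
    intro g
    by_cases hg : g ∈ U
    · have := count_lt (F := F) hU (c := g) (by rwa [hUa g hg])
      omega
    · rw [Multiset.count_eq_zero_of_notMem hg]
      omega)
  obtain ⟨⟨u₁, v₁⟩, ⟨u₂, v₂⟩, L, rfl⟩ : ∃ p q L', L = p :: q :: L' := by
    match L, hL with
    | p :: q :: L', _ => exact ⟨p, q, L', rfl⟩
    | [_], h => simp at h; omega
    | [], h => simp at h; omega
  have hEq : (z ::ₘ ((((u₁, v₁) :: (u₂, v₂) :: L).map Prod.fst : List G) +
      (((u₁, v₁) :: (u₂, v₂) :: L).map Prod.snd : List G) : Multiset G)) =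
      ((L.map Prod.fst : List G) + (L.map Prod.snd : List G) +
        ([u₁, v₁, u₂, v₂, z] : List G) : Multiset G) := by
    simp only [List.map_cons, ← Multiset.cons_coe, ← Multiset.singleton_add, Multiset.coe_nil]
    abel
  rw [hEq] at hU hUa ⊢
  refine lt_card_kernelProducts_of_pairs ha hm ?_ (hne (u₁, v₁) (by simp)) (hne (u₂, v₂) (by simp))
    (fun q hq => hne q (by simp [hq])) hU hUa
  simp at hL
  omega

end CyclicFrobenius

/-! ### The dihedral case `m = 2`. -/

namespace CyclicFrobenius

variable {G : Type*} [Group G] {n : ℕ} {F : CyclicFrobenius G 2 n}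

theorem add_self_eq_zero_of_zmod_two (a : ZMod 2) : a + a = 0 := by
  revert a
  decide

theorem mul_self_eq_one {g : G} (hg : F.deg g ≠ 0) : g * g = 1 := by
  rw [← pow_two]
  exact F.pow_eq_one hg

theorem char_eq_neg_one {a : ZMod 2} (ha : a ≠ 0) : F.char a = -1 := by
  have h1 : F.char a * F.char a = 1 := by
    rw [← F.char_add, add_self_eq_zero_of_zmod_two, F.char_zero]
  have h2 : (F.char a + 1) * (F.char a - 1) = 0 := by linear_combination h1
  exact eq_neg_of_add_eq_zero_left ((F.isUnit_char_sub_one a ha).mul_left_eq_zero.1 h2)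

theorem ne_of_le_of_deg_ne_zero {S : Multiset G} (hS : ProductOneFree S) {g h : G}
    (hg : F.deg g ≠ 0) (hle : ({g, h} : Multiset G) ≤ S) : g ≠ h := by
  rintro rfl
  exact hS.prod_ne_one (l := [g, g]) hle (by simp) (by simp [F.mul_self_eq_one hg])

variable [NeZero n]

/-- Three reflections may have only three kernel products, and `0, u, -u` are already distinct. The
exponents of `g₁ * g₃` and `g₂ * g₃` must lie among them, which fixes `g₃` and forces `3 * u = 0`.
-/
theorem reflections_of_extremal {a : ZMod 2} (ha : a ≠ 0) {g₁ g₂ g₃ : G} {V : Multiset G}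
    (hS : ProductOneFree (({g₁, g₂, g₃} : Multiset G) + V))
    (hV : (V.map F.deg).sum = 0) (hcard : (({g₁, g₂, g₃} : Multiset G) + V).card + 2 = 2 + n)
    (h₁ : F.deg g₁ = a) (h₂ : F.deg g₂ = a) (h₃ : F.deg g₃ = a) {u : ZMod n}
    (hu : g₂ = g₁ * F.rot u) : u ≠ 0 ∧ u + u = -u ∧ g₃ = g₁ * F.rot (-u) ∧
      {0, u, -u} ⊆ F.kernelProducts {g₁, g₂, g₃} := by
  obtain ⟨v, hv⟩ := F.exists_eq_mul_rot (h₃.trans h₁.symm)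
  have hE := card_kernelProducts_add_le hS hV hcard
  have hE' : (F.kernelProducts {g₁, g₂, g₃}).card ≤ 3 := by simpa using hE
  have hU := hS.mono (Multiset.le_add_right {g₁, g₂, g₃} V)
  have h12 : g₁ ≠ g₂ := ne_of_le_of_deg_ne_zero (F := F) hU (h₁ ▸ ha) (by simp)
  have h13 : g₁ ≠ g₃ := ne_of_le_of_deg_ne_zero (F := F) hU (h₁ ▸ ha) (by
    simp [Multiset.cons_le_cons_iff])
  have h23 : g₂ ≠ g₃ := ne_of_le_of_deg_ne_zero (F := F) hU (h₂ ▸ ha) (by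
    simpa using Multiset.le_cons_self {g₂, g₃} g₁)
  have hu0 : u ≠ 0 := by
    rintro rfl
    exact h12 (by rw [hu, F.rot_zero, mul_one])
  have hv0 : v ≠ 0 := by
    rintro rfl
    exact h13 (by rw [hv, F.rot_zero, mul_one])
  have huv : v ≠ u := by
    rintro rfl
    exact h23 (by rw [hu, hv])
  have hsq := F.mul_self_eq_one (h₁ ▸ ha : F.deg g₁ ≠ 0)
  have hconj : ∀ t, F.rot t * g₁ = g₁ * F.rot (-t) := fun t => by
    rw [F.rot_mul, h₁, char_eq_neg_one ha, mul_neg_one]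
  have hneg : ∀ t : ZMod n, t ≠ 0 → t ≠ -t := by
    intro t ht h
    exact ht (F.eq_zero_of_mul_char_eq ha (by rw [char_eq_neg_one ha, mul_neg_one, ← h]))
  have m12 : u ∈ F.kernelProducts {g₁, g₂, g₃} :=
    mem_kernelProducts.2 ⟨[g₁, g₂], Multiset.le_add_right ({g₁, g₂} : Multiset G) {g₃}, by
      simp [hu, ← mul_assoc, hsq]⟩
  have m21 : -u ∈ F.kernelProducts {g₁, g₂, g₃} :=
    mem_kernelProducts.2 ⟨[g₂, g₁], by
      rw [← Multiset.cons_coe, ← Multiset.cons_coe, Multiset.cons_swap]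
      exact Multiset.le_add_right ({g₁, g₂} : Multiset G) {g₃}, by
      simp [hu, mul_assoc, hconj, ← mul_assoc g₁ g₁, hsq]⟩
  have m13 : v ∈ F.kernelProducts {g₁, g₂, g₃} :=
    mem_kernelProducts.2 ⟨[g₁, g₃], by simp [← Multiset.cons_coe, Multiset.cons_le_cons_iff], by
      simp [hv, ← mul_assoc, hsq]⟩
  have m23 : v - u ∈ F.kernelProducts {g₁, g₂, g₃} :=
    mem_kernelProducts.2 ⟨[g₂, g₃], Multiset.le_cons_self {g₂, g₃} g₁, by
      rw [List.prod_cons, List.prod_singleton, hu, hv, mul_assoc, ← mul_assoc (F.rot u), hconj,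
        ← mul_assoc, ← mul_assoc, hsq, one_mul, ← F.rot_add, neg_add_eq_sub]⟩
  have hsub : ({0, u, -u} : Finset (ZMod n)) ⊆ F.kernelProducts {g₁, g₂, g₃} := by
    intro z hz
    simp only [Finset.mem_insert, Finset.mem_singleton] at hz
    rcases hz with rfl | rfl | rfl
    · exact zero_mem_kernelProducts
    · exact m12
    · exact m21
  have hc3 : ({0, u, -u} : Finset (ZMod n)).card = 3 := by
    rw [Finset.card_insert_of_notMem, Finset.card_insert_of_notMem, Finset.card_singleton]
    · simpa using hneg u hu0
    · simp [hu0, hu0.symm]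
  have heq := Finset.eq_of_subset_of_card_le hsub (by rw [hc3]; exact hE')
  rw [← heq] at m13 m23
  obtain rfl : v = -u := by
    simpa [hv0, huv] using m13
  have h3u : u + u = -u := by
    simp only [Finset.mem_insert, Finset.mem_singleton] at m23
    rcases m23 with h | h | h
    · exact absurd (by linear_combination -h) (hneg u hu0)
    · linear_combination -h
    · exact absurd (by linear_combination -h) hu0
  exact ⟨hu0, h3u, hv, hsub⟩

/-- A kernel term `rot w` would raise the count to five, `0, u, -u, w, w + u`, where four are
allowed. A fourth reflection would equal `g₃`, since `g₁` and `g₂` determine the third one, and then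
its product with `g₃` is `1`. -/
theorem eq_zero_of_extremal {a : ZMod 2} (ha : a ≠ 0) {g₁ g₂ g₃ : G} {V : Multiset G}
    (hS : ProductOneFree (({g₁, g₂, g₃} : Multiset G) + V))
    (hV : (V.map F.deg).sum = 0) (hcard : (({g₁, g₂, g₃} : Multiset G) + V).card + 2 = 2 + n)
    (h₁ : F.deg g₁ = a) (h₂ : F.deg g₂ = a) (h₃ : F.deg g₃ = a)
    (hVa : ∀ g ∈ V, F.deg g = 0 ∨ F.deg g = a) : V = 0 := by
  obtain ⟨u, hu⟩ := F.exists_eq_mul_rot (h₂.trans h₁.symm)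
  obtain ⟨hu0, h3u, hg₃, hsub⟩ := reflections_of_extremal ha hS hV hcard h₁ h₂ h₃ hu
  rcases V.empty_or_exists_mem with rfl | ⟨c, hc⟩
  · rfl
  exfalso
  obtain ⟨V', rfl⟩ := Multiset.exists_cons_of_mem hc
  rcases hVa c hc with hc0 | hca
  · obtain ⟨w, rfl⟩ := (F.deg_eq_zero_iff c).1 hc0
    have hS' : ({g₁, g₂, g₃} : Multiset G) + F.rot w ::ₘ V' =
        ({F.rot w} + {g₁, g₂, g₃}) + V' := by
      simp only [← Multiset.singleton_add]
      abel
    rw [hS'] at hS hcard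
    have hE := card_kernelProducts_add_le hS (by simpa [hc0] using hV) hcard
    have hE' : (F.kernelProducts ({F.rot w} + {g₁, g₂, g₃})).card ≤ 4 := by simpa using hE
    have hU := hS.mono (Multiset.le_add_right ({F.rot w} + {g₁, g₂, g₃}) V')
    have hne : ∀ z ∈ F.kernelProducts {g₁, g₂, g₃}, w + z ≠ 0 := by
      intro z hz h0
      obtain ⟨l, hl, hlz⟩ := mem_kernelProducts.1 hz
      refine hU.prod_ne_one (l := F.rot w :: l) ?_ (by simp) ?_
      · rw [← Multiset.cons_coe, ← Multiset.singleton_add]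
        gcongr
      · rw [List.prod_cons, hlz, ← F.rot_add, h0, F.rot_zero]
    have hw0 : w ≠ 0 := by simpa using hne 0 (hsub (by simp))
    have hwu : w + u ≠ 0 := hne u (hsub (by simp))
    have hwu' : w - u ≠ 0 := by simpa [sub_eq_add_neg] using hne (-u) (hsub (by simp))
    have hadd : ∀ z ∈ F.kernelProducts {g₁, g₂, g₃},
        w + z ∈ F.kernelProducts ({F.rot w} + {g₁, g₂, g₃}) := by
      intro z hz
      obtain ⟨l, hl, hlz⟩ := mem_kernelProducts.1 hz
      refine mem_kernelProducts.2 ⟨F.rot w :: l, ?_, ?_⟩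
      · rw [← Multiset.cons_coe, ← Multiset.singleton_add]
        gcongr
      · rw [List.prod_cons, hlz, F.rot_add]
    have hsub5 : ({0, u, -u, w, w + u} : Finset (ZMod n)) ⊆
        F.kernelProducts ({F.rot w} + {g₁, g₂, g₃}) := by
      intro z hz
      have hmono := kernelProducts_mono (F := F)
        (Multiset.le_add_left {g₁, g₂, g₃} {F.rot w})
      simp only [Finset.mem_insert, Finset.mem_singleton] at hz
      rcases hz with rfl | rfl | rfl | rfl | rfl
      · exact zero_mem_kernelProducts
      · exact hmono (hsub (by simp))
      · exact hmono (hsub (by simp))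
      · simpa using hadd 0 (hsub (by simp))
      · exact hadd u (hsub (by simp))
    have hc5 : ({0, u, -u, w, w + u} : Finset (ZMod n)).card = 5 := by
      rw [Finset.card_insert_of_notMem, Finset.card_insert_of_notMem,
        Finset.card_insert_of_notMem, Finset.card_insert_of_notMem, Finset.card_singleton]
      · simpa using hu0
      · simp only [Finset.mem_insert, Finset.mem_singleton, not_or]
        exact ⟨fun h => hwu (by linear_combination -h),
          fun h => hwu' (by linear_combination -h - h3u)⟩
      · simp only [Finset.mem_insert, Finset.mem_singleton, not_or]
        exact ⟨fun h => hu0 (by linear_combination h3u - h), fun h => hwu' (by linear_combination -h),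
          fun h => hw0 (by linear_combination -h)⟩
      · simp only [Finset.mem_insert, Finset.mem_singleton, not_or]
        exact ⟨hu0.symm, fun h => hu0 (by linear_combination h), hw0.symm, hwu.symm⟩
    have := Finset.card_le_card hsub5
    omega
  · have hS' : ({g₁, g₂, g₃} : Multiset G) + c ::ₘ V' = {g₁, g₂, c} + g₃ ::ₘ V' := by
      simp only [Multiset.insert_eq_cons, ← Multiset.singleton_add]
      abel
    have hS'' : ({g₁, g₂, g₃} : Multiset G) + c ::ₘ V' = {g₃, c} + ({g₁, g₂} + V') := by
      simp only [Multiset.insert_eq_cons, ← Multiset.singleton_add]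
      abel
    obtain ⟨-, -, hc', -⟩ := reflections_of_extremal ha (hS' ▸ hS)
      (by simpa [h₃, hca] using hV) (hS' ▸ hcard) h₁ h₂ hca hu
    exact ne_of_le_of_deg_ne_zero (F := F) (hS'' ▸ hS) (h₃ ▸ ha) (Multiset.le_add_right _ _)
      (hg₃.trans hc'.symm)

end CyclicFrobenius

/-! ### Structure of the extremal sequences. -/

namespace CyclicFrobenius

variable {G : Type*} [Group G] {m n : ℕ} (F : CyclicFrobenius G m n)

/-- The exponent of a kernel element (and an arbitrary value outside the kernel). -/
noncomputable def exponent [NeZero n] (g : G) : ZMod n :=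
  Function.invFun F.rot g

theorem exponent_rot [NeZero n] (t : ZMod n) : F.exponent (F.rot t) = t :=
  Function.leftInverse_invFun F.rot_injective t

variable {F} [NeZero n]

theorem rot_exponent {g : G} (hg : F.deg g = 0) : F.rot (F.exponent g) = g := by
  obtain ⟨t, rfl⟩ := (F.deg_eq_zero_iff g).1 hg
  rw [exponent_rot]

theorem list_prod_eq_rot {l : List G} (hl : ∀ g ∈ l, F.deg g = 0) :
    l.prod = F.rot (l.map F.exponent).sum := by
  induction l with
  | nil => simp [F.rot_zero]
  | cons g l ih =>
    rw [List.prod_cons, List.map_cons, List.sum_cons, F.rot_add, rot_exponent (hl g (by simp)),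
      ih fun h hh => hl h (List.mem_cons_of_mem g hh)]

theorem zeroSumFree_exponent {W : Multiset G} (hW : ProductOneFree W)
    (hd : ∀ g ∈ W, F.deg g = 0) : ZeroSumFree F.exponent W := by
  intro T hT hT0 hsum
  obtain ⟨l, rfl⟩ := Quot.exists_rep T
  change (l : Multiset G) ≤ W at hT
  refine hW.prod_ne_one (l := l) hT ?_ ?_
  · rintro rfl
    exact hT0 rfl
  · rw [list_prod_eq_rot (F := F) fun g hg => hd g (Multiset.mem_of_le hT (by simpa using hg))]
    have : (l.map F.exponent).sum = 0 := hsum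
    rw [this, F.rot_zero]

/-- The structure of extremal product-one free sequences. -/
theorem structure_of_extremal [NeZero m] {S : Multiset G} (hS : ProductOneFree S)
    (hcard : S.card + 2 = m + n) :
    (∃ (a : ZMod m) (c : ZMod n) (R : Multiset G), addOrderOf a = m ∧ addOrderOf c = n ∧
      R.card + 1 = m ∧ (∀ g ∈ R, F.deg g = a) ∧ S = R + Multiset.replicate (n - 1) (F.rot c)) ∨
    (m = 2 ∧ n = 3 ∧ ∃ (g : G) (u : ZMod n), F.deg g ≠ 0 ∧ u ≠ 0 ∧
      S = {g, g * F.rot u, g * F.rot (-u)}) := by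
  classical
  obtain ⟨W, R, rfl, hW, hR⟩ := exists_zeroSum_add_zeroSumFree F.deg S
  rw [add_comm W R] at hS hcard ⊢
  obtain ⟨hRm, a, ha, hRa⟩ := exists_generator hS hW hcard hR
  have hWd := fun g => deg_eq_zero_or_eq (g := g) hS hW hcard ha hRm hRa
  obtain ⟨W₀, W₁, rfl, hW₀, hW₁⟩ : ∃ W₀ W₁ : Multiset G, W = W₀ + W₁ ∧
      (∀ g ∈ W₀, F.deg g = 0) ∧ ∀ g ∈ W₁, F.deg g ≠ 0 :=
    ⟨W.filter (F.deg · = 0), W.filter (F.deg · ≠ 0), (Multiset.filter_add_not _ W).symm,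
      fun g hg => (Multiset.mem_filter.1 hg).2, fun g hg => (Multiset.mem_filter.1 hg).2⟩
  have hW₁a : ∀ g ∈ W₁, F.deg g = a := fun g hg =>
    (hWd g (Multiset.mem_add.2 (Or.inr hg))).resolve_left (hW₁ g hg)
  rcases W₁.empty_or_exists_mem with rfl | ⟨w, hw⟩
  · left
    rw [add_zero] at hS hcard ⊢
    rw [Multiset.card_add] at hcard
    obtain ⟨hWn, c, hc, hWc⟩ := (zeroSumFree_exponent (hS.mono (Multiset.le_add_left W₀ R))
      hW₀).exists_generator (by omega)
    refine ⟨a, c, R, ha, hc, hRm, hRa, ?_⟩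
    have : W₀ = Multiset.replicate (n - 1) (F.rot c) :=
      Multiset.eq_replicate.2 ⟨by omega, fun g hg => by rw [← hWc g hg, rot_exponent (hW₀ g hg)]⟩
    rw [← this]
  · right
    have ha0 : a ≠ 0 := hW₁a w hw ▸ hW₁ w hw
    have hm2 : 2 ≤ m := by
      by_contra hlt
      have h1 : m = 1 := by
        have := NeZero.pos m
        omega
      exact ha0 (AddMonoid.addOrderOf_eq_one_iff.1 (ha.trans h1))
    have hsum₀ : (W₀.map F.deg).sum = 0 := by
      rw [Multiset.sum_map_eq_nsmul hW₀, smul_zero]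
    -- The degree sum of `W₁` is `|W₁| • a = 0`, so a nonempty `W₁` has at least `m` terms. Adding
    -- `m` of them to `R` gives `2 * m - 1` terms of degree `a`.
    have hdvd : m ∣ W₁.card := by
      rw [Multiset.map_add, Multiset.sum_add, hsum₀, zero_add, Multiset.sum_map_eq_nsmul hW₁a]
        at hW
      have := addOrderOf_dvd_of_nsmul_eq_zero hW
      rwa [ha] at this
    have hle := Nat.le_of_dvd (Multiset.card_pos_iff_exists_mem.2 ⟨w, hw⟩) hdvd
    obtain ⟨T, V, rfl, hT⟩ := W₁.exists_add_of_le_card hle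
    have hTa : ∀ g ∈ R + T, F.deg g = a := by
      intro g hg
      rcases Multiset.mem_add.1 hg with hg | hg
      · exact hRa g hg
      · exact hW₁a g (by simp [hg])
    have hTs : (T.map F.deg).sum = 0 := by
      rw [Multiset.sum_map_eq_nsmul fun g hg => hTa g (by simp [hg]), hT]
      simp
    have hsplit : R + (W₀ + (T + V)) = (R + T) + (W₀ + V) := by abel
    have hVs : ((W₀ + V).map F.deg).sum = 0 := by
      simpa [hsum₀, hTs] using hW
    rw [hsplit] at hS hcard ⊢
    have hE := card_kernelProducts_add_le hS hVs hcard
    have hU := hS.mono (Multiset.le_add_right (R + T) (W₀ + V))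
    rw [Multiset.card_add] at hE
    rcases eq_or_lt_of_le hm2 with rfl | hm3
    · obtain ⟨g₁, rfl⟩ := Multiset.card_eq_one.1 (show R.card = 1 by omega)
      obtain ⟨g₂, g₃, rfl⟩ := Multiset.card_eq_two.1 hT
      have hset : ({g₁} + {g₂, g₃} : Multiset G) = {g₁, g₂, g₃} := Multiset.singleton_add _ _
      rw [hset] at hS hcard hTa ⊢
      have h₁ := hTa g₁ (by simp)
      have h₂ := hTa g₂ (by simp)
      have h₃ := hTa g₃ (by simp)
      have hV0 := eq_zero_of_extremal ha0 hS hVs hcard h₁ h₂ h₃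
        (fun g hg => hWd g (by
          rcases Multiset.mem_add.1 hg with hg | hg <;> simp [hg]))
      obtain ⟨u, hu⟩ := F.exists_eq_mul_rot (h₂.trans h₁.symm)
      obtain ⟨hu0, -, hg₃, -⟩ := reflections_of_extremal ha0 hS hVs hcard h₁ h₂ h₃ hu
      rw [hV0, add_zero] at hcard ⊢
      have hn3 : n = 3 := by
        simp at hcard
        omega
      exact ⟨rfl, hn3, g₁, u, h₁ ▸ ha0, hu0, by rw [hu, hg₃]⟩
    · exfalso
      have := lt_card_kernelProducts_of_deg_eq ha hm3 hU hTa (by rw [Multiset.card_add]; omega)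
      omega

end CyclicFrobenius

/-! ### Sequences that are product-one free. -/

namespace CyclicFrobenius

variable {G : Type*} [Group G] {m n : ℕ} {F : CyclicFrobenius G m n}

/-- The standard extremal sequences are product-one free. -/
theorem productOneFree_add_replicate {a : ZMod m} {c : ZMod n} (ha : addOrderOf a = m)
    (hc : addOrderOf c = n) {R : Multiset G} (hR : R.card < m) (hRa : ∀ g ∈ R, F.deg g = a)
    {k : ℕ} (hk : k < n) : ProductOneFree (R + Multiset.replicate k (F.rot c)) := by
  classical
  rintro T hT hT0 ⟨l, rfl, hl⟩
  obtain ⟨T₁, T₂, hT₁, hT₂, hTT⟩ : ∃ T₁ T₂ : Multiset G, T₁ ≤ R ∧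
      T₂ ≤ Multiset.replicate k (F.rot c) ∧ (l : Multiset G) = T₁ + T₂ :=
    ⟨l ∩ R, l - R, Multiset.inter_le_right, by
      rw [tsub_le_iff_left]
      exact hT, by rw [add_comm, Multiset.sub_add_inter]⟩
  obtain ⟨j, hj⟩ : ∃ j, T₂ = Multiset.replicate j (F.rot c) :=
    ⟨T₂.card, Multiset.eq_replicate_card.2 fun b hb =>
      Multiset.eq_of_mem_replicate (Multiset.mem_of_le hT₂ hb)⟩
  subst hj
  have hjk : j ≤ k := by simpa using Multiset.card_le_card hT₂
  have hdeg := F.deg_prod l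
  rw [hl, F.deg_one, hTT, Multiset.map_add, Multiset.sum_add,
    Multiset.sum_map_eq_nsmul (a := a) fun g hg => hRa g (Multiset.mem_of_le hT₁ hg)] at hdeg
  simp only [Multiset.map_replicate, F.deg_rot, Multiset.sum_replicate, smul_zero, add_zero]
    at hdeg
  -- Fewer than `m` terms of degree `a` have degree sum zero only if there are none; what remains is
  -- a power of `rot c` with exponent below its order.
  have hT₁0 : T₁ = 0 := by
    by_contra hne
    exact nsmul_ne_zero_of_lt_addOrderOf (x := a) (by simpa using hne)
      (by have := Multiset.card_le_card hT₁; omega) hdeg.symm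
  rw [hT₁0, zero_add] at hTT
  have hlr : l = List.replicate j (F.rot c) := by
    rw [List.eq_replicate_iff]
    constructor
    · simpa using congrArg Multiset.card hTT
    · intro b hb
      exact Multiset.eq_of_mem_replicate (n := j) (hTT ▸ (by simpa using hb))
  have hpow : ∀ i : ℕ, F.rot c ^ i = F.rot (i • c) := by
    intro i
    induction i with
    | zero => simp [F.rot_zero]
    | succ i ih => rw [pow_succ, succ_nsmul, F.rot_add, ih]
  rw [hlr, List.prod_replicate, hpow, F.rot_eq_one_iff] at hl
  have hj0 : j ≠ 0 := by
    rintro rfl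
    exact hT0 (by simpa using hTT)
  exact nsmul_ne_zero_of_lt_addOrderOf (x := c) hj0 (by omega) hl

/-- Three distinct reflections form a product-one free sequence. -/
theorem productOneFree_of_reflections {F : CyclicFrobenius G 2 n} {S : Multiset G}
    (hd : ∀ g ∈ S, F.deg g ≠ 0) (hnd : S.Nodup) (hS : S.card ≤ 3) : ProductOneFree S := by
  rintro T hT hT0 ⟨l, rfl, hl⟩
  have h1 : ∀ g ∈ l, F.deg g = 1 := fun g hg => by
    have : ∀ z : ZMod 2, z ≠ 0 → z = 1 := by decide
    exact this _ (hd g (Multiset.mem_of_le hT (by simpa using hg)))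
  have hdeg := deg_list_prod_eq_nsmul h1
  rw [hl, F.deg_one, nsmul_one, eq_comm, ZMod.natCast_eq_zero_iff] at hdeg
  have hlen : l.length ≤ 3 := by simpa using (Multiset.card_le_card hT).trans hS
  -- The length is even, positive and at most three, so it is two, and a product of two distinct
  -- involutions is not `1`.
  have hl0 : l ≠ [] := by simpa using hT0
  have hpos := List.length_pos_iff.2 hl0
  obtain ⟨g, h, rfl⟩ := List.length_eq_two.1 (show l.length = 2 by omega)
  have hne : g ≠ h := by
    have := Multiset.nodup_of_le hT hnd
    simpa using this
  have hsq := F.mul_self_eq_one (hd g (Multiset.mem_of_le hT (by simp)))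
  rw [List.prod_cons, List.prod_singleton, ← hsq, mul_right_inj] at hl
  exact hne hl.symm

end CyclicFrobenius

/-! ### The presented group: normal form and Frobenius structure. -/

namespace Metacyclic

variable (m n : ℕ) (s : ℤ)

theorem x_pow : x m n s ^ m = 1 :=
  PresentedGroup.one_of_mem (rels := metacyclicRels m n s) (x := FreeGroup.of 0 ^ m)
    (by simp [metacyclicRels])

theorem y_pow : y m n s ^ n = 1 :=
  PresentedGroup.one_of_mem (rels := metacyclicRels m n s) (x := FreeGroup.of 1 ^ n)
    (by simp [metacyclicRels])

theorem x_inv_mul_y_mul_x : (x m n s)⁻¹ * y m n s * x m n s = y m n s ^ s := by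
  have := PresentedGroup.one_of_mem (rels := metacyclicRels m n s)
    (x := (FreeGroup.of 0)⁻¹ * FreeGroup.of 1 * FreeGroup.of 0 * (FreeGroup.of 1 ^ s)⁻¹)
    (by simp [metacyclicRels])
  rw [map_mul, map_inv, mul_inv_eq_one, map_zpow] at this
  exact this

variable {m n s}

/-- The homomorphism out of `Metacyclic m n s` determined by the images of `x` and `y`. -/
def lift {H : Type*} [Group H] (u v : H) (hu : u ^ m = 1) (hv : v ^ n = 1)
    (huv : u⁻¹ * v * u = v ^ s) : Metacyclic m n s →* H :=
  PresentedGroup.toGroup (f := ![u, v]) (by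
    intro r hr
    simp only [metacyclicRels, Set.mem_insert_iff, Set.mem_singleton_iff] at hr
    rcases hr with rfl | rfl | rfl
    · simpa using hu
    · simpa using hv
    · simpa [mul_inv_eq_one] using huv)

section

variable {H : Type*} [Group H] {u v : H} (hu : u ^ m = 1) (hv : v ^ n = 1)
  (huv : u⁻¹ * v * u = v ^ s)

theorem lift_x : lift u v hu hv huv (x m n s) = u :=
  PresentedGroup.toGroup.of _

theorem lift_y : lift u v hu hv huv (y m n s) = v :=
  PresentedGroup.toGroup.of _

end

theorem hom_ext {H : Type*} [Group H] {φ ψ : Metacyclic m n s →* H}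
    (hx : φ (x m n s) = ψ (x m n s)) (hy : φ (y m n s) = ψ (y m n s)) : φ = ψ := by
  refine PresentedGroup.ext fun i => ?_
  fin_cases i
  · exact hx
  · exact hy

theorem y_zpow_eq_of_modEq {j k : ℤ} (h : j ≡ k [ZMOD n]) : y m n s ^ j = y m n s ^ k := by
  obtain ⟨d, hd⟩ := h.symm.dvd
  rw [← sub_add_cancel j k, hd, zpow_add, zpow_mul, zpow_natCast, y_pow, one_zpow, one_mul]

/-- `Metacyclic m n s` depends only on `s` modulo `n`. -/
theorem nonempty_mulEquiv_of_modEq {s' : ℤ} (h : s ≡ s' [ZMOD n]) :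
    Nonempty (Metacyclic m n s ≃* Metacyclic m n s') := by
  refine ⟨MonoidHom.toMulEquiv
    (lift (x m n s') (y m n s') (x_pow m n s') (y_pow m n s')
      ((x_inv_mul_y_mul_x m n s').trans (y_zpow_eq_of_modEq h.symm)))
    (lift (x m n s) (y m n s) (x_pow m n s) (y_pow m n s)
      ((x_inv_mul_y_mul_x m n s).trans (y_zpow_eq_of_modEq h))) ?_ ?_⟩
  · exact hom_ext (by simp [lift_x]) (by simp [lift_y])
  · exact hom_ext (by simp [lift_x]) (by simp [lift_y])

theorem y_zpow_mul_x (j : ℤ) : y m n s ^ j * x m n s = x m n s * y m n s ^ (j * s) := by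
  rw [mul_comm j s, zpow_mul, ← x_inv_mul_y_mul_x]
  have := map_zpow (MulAut.conj (x m n s)⁻¹) (y m n s) j
  simp only [MulAut.conj_apply, inv_inv] at this
  rw [← this]
  group

theorem y_zpow_mul_x_pow (j : ℤ) (i : ℕ) :
    y m n s ^ j * x m n s ^ i = x m n s ^ i * y m n s ^ (j * s ^ i) := by
  induction i with
  | zero => simp
  | succ i ih =>
    rw [pow_succ, ← mul_assoc, ih, mul_assoc, y_zpow_mul_x, ← mul_assoc, pow_succ, mul_assoc j]

theorem exists_eq_x_pow_mul_y_zpow (hm : 0 < m) (g : Metacyclic m n s) :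
    ∃ (i : ℕ) (j : ℤ), g = x m n s ^ i * y m n s ^ j := by
  induction g using PresentedGroup.induction_on with
  | _ z =>
  induction z using FreeGroup.induction_on with
  | C1 => exact ⟨0, 0, by simp⟩
  | of i =>
    fin_cases i
    · exact ⟨1, 0, by simp; rfl⟩
    · exact ⟨0, 1, by simp; rfl⟩
  | inv_of i _ =>
    fin_cases i
    · refine ⟨m - 1, 0, ?_⟩
      have h : x m n s ^ (m - 1) * x m n s = 1 := by
        rw [← pow_succ, Nat.sub_add_cancel hm, x_pow]
      rw [zpow_zero, mul_one, eq_inv_of_mul_eq_one_left h, map_inv]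
      rfl
    · exact ⟨0, -1, by simp; rfl⟩
  | mul a b ha hb =>
    obtain ⟨i, j, ha⟩ := ha
    obtain ⟨k, l, hb⟩ := hb
    refine ⟨i + k, j * s ^ k + l, ?_⟩
    rw [map_mul, ha, hb, mul_assoc, ← mul_assoc (y m n s ^ j), y_zpow_mul_x_pow, zpow_add, pow_add]
    simp only [mul_assoc]

/-- The degree in `x`. -/
def degree : Metacyclic m n s →* Multiplicative (ZMod m) :=
  lift (Multiplicative.ofAdd 1) 1
    (by rw [← ofAdd_nsmul, nsmul_one, ZMod.natCast_self, ofAdd_zero]) (one_pow n) (by simp)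

theorem degree_x_pow_mul_y_zpow (i : ℕ) (j : ℤ) :
    (degree (x m n s ^ i * y m n s ^ j)).toAdd = i := by
  simp [degree, lift_x, lift_y]

/-- `y` has order `n`. -/
theorem dvd_of_y_zpow_eq_one (hm : 0 < m) (hs : s ^ m ≡ 1 [ZMOD (n : ℤ)]) {j : ℤ}
    (h : y m n s ^ j = 1) : (j : ZMod n) = 0 := by
  have hs' : (s : ZMod n) ^ m = 1 := by
    have := (ZMod.intCast_eq_intCast_iff _ _ n).2 hs
    simpa using this
  obtain ⟨u, hu⟩ : IsUnit (s : ZMod n) := IsUnit.of_pow_eq_one hs' hm.ne'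
  have hum : u ^ m = 1 := by
    ext
    simpa [hu] using hs'
  -- Affine action on `ZMod n`: `x` multiplies by `s⁻¹` and `y` adds `1`, so conjugation gives
  -- translation by `s`. Evaluating `y ^ j` at `0` recovers `j` modulo `n`.
  let X : Equiv.Perm (ZMod n) := MulAction.toPermHom (ZMod n)ˣ (ZMod n) u⁻¹
  have hX : X⁻¹ = MulAction.toPermHom (ZMod n)ˣ (ZMod n) u := by
    rw [← map_inv, inv_inv]
  let Y : Equiv.Perm (ZMod n) := Equiv.addLeft 1
  have hY : ∀ (k : ℤ) (z : ZMod n), (Y ^ k) z = k + z := by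
    intro k z
    simp [Y]
  let φ : Metacyclic m n s →* Equiv.Perm (ZMod n) := lift X Y
    (by simp only [X]; rw [← map_pow, inv_pow, hum, inv_one, map_one])
    (by
      ext z
      have := hY n z
      rw [zpow_natCast] at this
      simp [this])
    (by
      ext z
      rw [hY, hX, ← hu]
      simp only [X, Y, Equiv.Perm.mul_apply, MulAction.toPermHom_apply,
        MulAction.toPerm_apply, Equiv.coe_addLeft, Units.smul_def, smul_eq_mul, mul_add,
        Units.mul_inv_cancel_left, mul_one])
  have h1 := congrArg (fun f => φ f 0) h
  simp only [map_zpow, map_one, φ, lift_y, hY] at h1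
  simpa using h1

theorem pow_val_add {M : Type*} [Monoid M] {k : ℕ} [NeZero k] {g : M} (hg : g ^ k = 1)
    (a b : ZMod k) : g ^ (a + b).val = g ^ a.val * g ^ b.val := by
  rw [ZMod.val_add, ← pow_eq_pow_mod _ hg, pow_add]

theorem pow_val_natCast {M : Type*} [Monoid M] {k : ℕ} {g : M} (hg : g ^ k = 1)
    (i : ℕ) : g ^ (i : ZMod k).val = g ^ i := by
  rw [ZMod.val_natCast, ← pow_eq_pow_mod _ hg]

theorem y_pow_val [NeZero n] (j : ℤ) : y m n s ^ (j : ZMod n).val = y m n s ^ j := by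
  rw [← zpow_natCast]
  apply y_zpow_eq_of_modEq
  rw [← ZMod.intCast_eq_intCast_iff]
  simp

/-- The Frobenius structure of `Metacyclic m n s`. -/
noncomputable def cyclicFrobenius (hm : 0 < m) (hn : 0 < n) (hs : s ^ m ≡ 1 [ZMOD (n : ℤ)])
    (hord : ∀ q : ℕ, q.Prime → q ∣ n → orderOf (s : ZMod q) = m) :
    CyclicFrobenius (Metacyclic m n s) m n where
  deg g := (degree g).toAdd
  rot t := y m n s ^ t.val
  char d := (s : ZMod n) ^ d.val
  deg_mul g h := by simp
  rot_add t u :=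
    have : NeZero n := ⟨hn.ne'⟩
    pow_val_add (y_pow m n s) t u
  rot_injective t u h := by
    have : NeZero n := ⟨hn.ne'⟩
    have h1 : y m n s ^ ((t.val : ℤ) - u.val) = 1 := by
      simp only at h
      rw [zpow_sub, zpow_natCast, zpow_natCast, h, mul_inv_cancel]
    have h2 := dvd_of_y_zpow_eq_one hm hs h1
    simpa [sub_eq_zero] using h2
  deg_eq_zero_iff g := by
    have : NeZero n := ⟨hn.ne'⟩
    obtain ⟨i, j, rfl⟩ := exists_eq_x_pow_mul_y_zpow hm g
    rw [degree_x_pow_mul_y_zpow]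
    constructor
    · intro h
      refine ⟨j, ?_⟩
      obtain ⟨k, rfl⟩ := (ZMod.natCast_eq_zero_iff i m).1 h
      rw [y_pow_val, pow_mul, x_pow, one_pow, one_mul]
    · rintro ⟨t, ht⟩
      rw [← degree_x_pow_mul_y_zpow (n := n) (s := s) i j, ← ht]
      simpa using degree_x_pow_mul_y_zpow (m := m) (n := n) (s := s) 0 t.val
  char_add d e :=
    have : NeZero m := ⟨hm.ne'⟩
    pow_val_add (by simpa using (ZMod.intCast_eq_intCast_iff _ _ n).2 hs) d e
  char_zero := by simp
  isUnit_char_sub_one d hd := by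
    have : NeZero m := ⟨hm.ne'⟩
    have hcast : (s : ZMod n) ^ d.val - 1 = ((s ^ d.val - 1 : ℤ) : ZMod n) := by simp
    rw [hcast, ZMod.coe_int_isUnit_iff_isCoprime]
    rw [Int.isCoprime_iff_gcd_eq_one]
    by_contra hne
    -- A prime dividing both `n` and `s ^ d - 1` would make the order `m` of `s` modulo `q` divide
    -- `d`, where `0 < d < m`.
    obtain ⟨q, hq, hqd⟩ := Nat.exists_prime_and_dvd hne
    have hqn : q ∣ n := by
      have := hqd.trans (Int.gcd_dvd_natAbs_left _ _)
      simpa using this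
    have hqs : (q : ℤ) ∣ s ^ d.val - 1 :=
      (Int.natCast_dvd_natCast.2 hqd).trans (Int.gcd_dvd_right _ _)
    have h1 : (s : ZMod q) ^ d.val = 1 := by
      have := (ZMod.intCast_zmod_eq_zero_iff_dvd _ q).2 hqs
      simpa [sub_eq_zero] using this
    have h2 := orderOf_dvd_of_pow_eq_one h1
    rw [hord q hq hqn] at h2
    have h3 := Nat.le_of_dvd (ZMod.val_pos.2 hd) h2
    exact absurd (ZMod.val_lt d) (by omega)
  rot_mul t g := by
    have : NeZero n := ⟨hn.ne'⟩
    obtain ⟨i, j, rfl⟩ := exists_eq_x_pow_mul_y_zpow hm g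
    have h1 : (t * (s : ZMod n) ^ (i : ZMod m).val) = ((t.val * s ^ i : ℤ) : ZMod n) := by
      rw [pow_val_natCast (by simpa using (ZMod.intCast_eq_intCast_iff _ _ n).2 hs)]
      simp
    rw [degree_x_pow_mul_y_zpow, h1, y_pow_val, ← zpow_natCast (y m n s) t.val, ← mul_assoc,
      y_zpow_mul_x_pow, mul_assoc, mul_assoc, ← zpow_add, ← zpow_add, add_comm]

end Metacyclic

/-! ### Recognizing the exceptional group. -/

theorem Multiset.exists_eq_map_univ {α : Type*} {k : ℕ} {R : Multiset α} (hR : R.card = k) :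
    ∃ f : Fin k → α, R = Multiset.map f (Finset.univ : Finset (Fin k)).val := by
  induction R using Quotient.inductionOn with
  | _ l =>
  subst hR
  refine ⟨l.get, ?_⟩
  change (l : Multiset α) = Multiset.map l.get (Finset.univ : Finset (Fin l.length)).val
  rw [Fin.univ_val_map, List.ofFn_get]

theorem ZMod.gcd_val_of_addOrderOf_eq {k : ℕ} [NeZero k] {a : ZMod k} (ha : addOrderOf a = k) :
    Nat.gcd a.val k = 1 := by
  rw [← ZMod.natCast_zmod_val a, ZMod.addOrderOf_coe _ (NeZero.ne k)] at ha
  have h1 := Nat.div_mul_cancel (Nat.gcd_dvd_left k a.val)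
  rw [ha] at h1
  rw [Nat.gcd_comm]
  exact Nat.eq_of_mul_eq_mul_left (NeZero.pos k) (h1.trans (mul_one k).symm)

theorem ZMod.addOrderOf_natCast_of_gcd_eq_one {k a : ℕ} (hk : 0 < k) (ha : Nat.gcd a k = 1) :
    addOrderOf (a : ZMod k) = k := by
  rw [ZMod.addOrderOf_coe _ hk.ne', Nat.gcd_comm, ha, Nat.div_one]

namespace CyclicFrobenius

variable {G : Type*} [Group G] {m n : ℕ} (F : CyclicFrobenius G m n)

theorem card_eq [NeZero m] (hdeg : Function.Surjective F.deg) : Nat.card G = m * n := by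
  choose f hf using hdeg
  have hbij : Function.Bijective fun p : ZMod m × ZMod n => f p.1 * F.rot p.2 := by
    constructor
    · rintro ⟨d, t⟩ ⟨e, u⟩ h
      have h1 := congrArg F.deg h
      simp only [F.deg_mul, hf, F.deg_rot, add_zero] at h1
      subst h1
      simpa [F.rot_injective.eq_iff] using h
    · intro g
      obtain ⟨t, ht⟩ := F.exists_eq_mul_rot (hf (F.deg g)).symm
      exact ⟨(F.deg g, t), ht.symm⟩
  rw [← Nat.card_congr (Equiv.ofBijective _ hbij), Nat.card_prod, Nat.card_zmod, Nat.card_zmod]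

end CyclicFrobenius

theorem CyclicFrobenius.commute_of_left_eq_one {G : Type*} [Group G] {n : ℕ}
    (F : CyclicFrobenius G 1 n) (g h : G) : g * h = h * g := by
  obtain ⟨t, rfl⟩ := (F.deg_eq_zero_iff g).1 (Subsingleton.elim _ _)
  obtain ⟨u, rfl⟩ := (F.deg_eq_zero_iff h).1 (Subsingleton.elim _ _)
  rw [← F.rot_add, ← F.rot_add, add_comm]

theorem CyclicFrobenius.commute_of_right_eq_one {G : Type*} [Group G] {m : ℕ}
    (F : CyclicFrobenius G m 1) (g h : G) : g * h = h * g := by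
  obtain ⟨t, ht⟩ := F.exists_eq_mul_rot (g := g * h) (h := h * g)
    (by rw [F.deg_mul, F.deg_mul, add_comm])
  rw [ht, Subsingleton.elim t 0, F.rot_zero, mul_one]

namespace Metacyclic

variable {m n : ℕ} {s : ℤ} (hm : 0 < m) (hn : 0 < n) (hs : s ^ m ≡ 1 [ZMOD (n : ℤ)])
  (hord : ∀ q : ℕ, q.Prime → q ∣ n → orderOf (s : ZMod q) = m)

theorem deg_x_pow_mul_y_pow (i j : ℕ) :
    (cyclicFrobenius hm hn hs hord).deg (x m n s ^ i * y m n s ^ j) = i := by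
  have := degree_x_pow_mul_y_zpow (m := m) (n := n) (s := s) i j
  rwa [zpow_natCast] at this

theorem rot_natCast (j : ℕ) : (cyclicFrobenius hm hn hs hord).rot j = y m n s ^ j :=
  pow_val_natCast (y_pow m n s) j

theorem eq_x_pow_mul_rot {g : Metacyclic m n s} {i : ℕ}
    (hg : (cyclicFrobenius hm hn hs hord).deg g = i) :
    ∃ t, g = x m n s ^ i * (cyclicFrobenius hm hn hs hord).rot t := by
  refine (cyclicFrobenius hm hn hs hord).exists_eq_mul_rot (hg.trans ?_)
  simpa using (deg_x_pow_mul_y_pow hm hn hs hord i 0).symm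

end Metacyclic

theorem ZMod.intCast_eq_two_of_orderOf_eq_two {s : ℤ} (h : orderOf (s : ZMod 3) = 2) : (s : ZMod 3) = 2 := by
  have key : ∀ z : ZMod 3, z = 0 ∨ z = 1 ∨ z = 2 := by decide
  rcases key s with h0 | h0 | h0
  · have := pow_orderOf_eq_one (s : ZMod 3)
    rw [h, h0] at this
    exact absurd this (by decide)
  · rw [h0, orderOf_one] at h
    omega
  · exact h0

namespace Metacyclic

theorem card_eq {m n : ℕ} {s : ℤ} (hm : 0 < m) (hn : 0 < n) (hs : s ^ m ≡ 1 [ZMOD (n : ℤ)])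
    (hord : ∀ q : ℕ, q.Prime → q ∣ n → orderOf (s : ZMod q) = m) :
    Nat.card (Metacyclic m n s) = m * n := by
  have : NeZero m := ⟨hm.ne'⟩
  refine (cyclicFrobenius hm hn hs hord).card_eq fun d => ⟨x m n s ^ d.val * y m n s ^ 0, ?_⟩
  rw [deg_x_pow_mul_y_pow, ZMod.natCast_zmod_val]

theorem orderOf_two_of_prime_dvd_three (q : ℕ) (hq : q.Prime) (hq3 : q ∣ 3) :
    orderOf (((2 : ℤ)) : ZMod q) = 2 := by
  obtain rfl := (Nat.prime_dvd_prime_iff_eq hq Nat.prime_three).1 hq3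
  exact orderOf_eq_prime (by decide) (by decide)

/-- An isomorphism forces `m * n = 6` and noncommutativity. The cases `m = 1` and `n = 1` are
abelian, and `m = 3`, `n = 2` would need an element of order `3` modulo `2`. Conversely, order `2`
modulo `3` means `s ≡ 2`. -/
theorem nonempty_mulEquiv_two_three_iff {m n : ℕ} {s : ℤ} (hm : 0 < m) (hn : 0 < n)
    (hs : s ^ m ≡ 1 [ZMOD (n : ℤ)])
    (hord : ∀ q : ℕ, q.Prime → q ∣ n → orderOf (s : ZMod q) = m) :
    Nonempty (Metacyclic m n s ≃* Metacyclic 2 3 2) ↔ m = 2 ∧ n = 3 := by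
  have h23 : (2 : ℤ) ^ 2 ≡ 1 [ZMOD ((3 : ℕ) : ℤ)] := by decide
  constructor
  · rintro ⟨e⟩
    have hcard : m * n = 2 * 3 := by
      rw [← card_eq hm hn hs hord, Nat.card_congr e.toEquiv,
        card_eq two_pos three_pos h23 orderOf_two_of_prime_dvd_three]
    have hnc : ¬ ∀ g h : Metacyclic m n s, g * h = h * g := by
      intro hc
      have h1 := congrArg e (hc (e.symm (y 2 3 2)) (e.symm (x 2 3 2)))
      rw [map_mul, map_mul, e.apply_symm_apply, e.apply_symm_apply] at h1
      have h2 := y_zpow_mul_x (m := 2) (n := 3) (s := 2) 1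
      rw [zpow_one, h1, mul_right_inj, one_mul] at h2
      have h3 : y 2 3 2 ^ (1 : ℤ) = 1 := by
        rw [zpow_one]
        have h4 : y 2 3 2 ^ (2 : ℤ) = y 2 3 2 * y 2 3 2 := zpow_two _
        rw [h4, left_eq_mul] at h2
        exact h2
      exact absurd (dvd_of_y_zpow_eq_one two_pos h23 h3) (by decide)
    have hm6 : m ∣ 2 * 3 := ⟨n, hcard.symm⟩
    have hm6' : m ≤ 6 := Nat.le_of_dvd (by norm_num) hm6
    interval_cases m
    · exact absurd (cyclicFrobenius hm hn hs hord).commute_of_left_eq_one hnc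
    · exact ⟨rfl, by omega⟩
    · exfalso
      obtain rfl : n = 2 := by omega
      have h2 := hord 2 Nat.prime_two dvd_rfl
      have h3 := pow_orderOf_eq_one (s : ZMod 2)
      rw [h2] at h3
      have key : ∀ z : ZMod 2, z ^ 3 = 1 → z = 1 := by decide
      rw [key _ h3, orderOf_one] at h2
      omega
    · omega
    · omega
    · obtain rfl : n = 1 := by omega
      exact absurd (cyclicFrobenius hm hn hs hord).commute_of_right_eq_one hnc
  · rintro ⟨rfl, rfl⟩
    apply nonempty_mulEquiv_of_modEq
    rw [← ZMod.intCast_eq_intCast_iff]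
    exact ZMod.intCast_eq_two_of_orderOf_eq_two (hord 3 Nat.prime_three dvd_rfl)

end Metacyclic

/-! ### The characterization in terms of `x` and `y`. -/

namespace Metacyclic

variable {m n : ℕ} {s : ℤ} (hm : 0 < m) (hn : 0 < n) (hs : s ^ m ≡ 1 [ZMOD (n : ℤ)])
  (hord : ∀ q : ℕ, q.Prime → q ∣ n → orderOf (s : ZMod q) = m)

theorem exists_standard_form {a : ZMod m} {c : ZMod n} (ha : addOrderOf a = m)
    (hc : addOrderOf c = n) {R : Multiset (Metacyclic m n s)} (hR : R.card + 1 = m)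
    (hRa : ∀ g ∈ R, (cyclicFrobenius hm hn hs hord).deg g = a) :
    ∃ (a' c' : ℕ) (b : Fin (m - 1) → ℕ), Nat.gcd a' m = 1 ∧ Nat.gcd c' n = 1 ∧
      R + Multiset.replicate (n - 1) ((cyclicFrobenius hm hn hs hord).rot c) =
        Multiset.map (fun i => x m n s ^ a' * y m n s ^ b i)
          (Finset.univ : Finset (Fin (m - 1))).val
        + Multiset.replicate (n - 1) (y m n s ^ c') := by
  have : NeZero m := ⟨hm.ne'⟩
  have : NeZero n := ⟨hn.ne'⟩
  obtain ⟨f, rfl⟩ := Multiset.exists_eq_map_univ (k := m - 1) (R := R) (by omega)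
  have hf : ∀ i, ∃ t, f i = x m n s ^ a.val * (cyclicFrobenius hm hn hs hord).rot t := fun i =>
    eq_x_pow_mul_rot hm hn hs hord (by
      rw [hRa (f i) (Multiset.mem_map_of_mem f (Finset.mem_univ i)), ZMod.natCast_zmod_val])
  choose t ht using hf
  refine ⟨a.val, c.val, fun i => (t i).val, ZMod.gcd_val_of_addOrderOf_eq ha,
    ZMod.gcd_val_of_addOrderOf_eq hc, ?_⟩
  congr 1
  exact Multiset.map_congr rfl fun i _ => ht i

theorem productOneFree_standard_form {a c : ℕ} (b : Fin (m - 1) → ℕ) (ha : Nat.gcd a m = 1)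
    (hc : Nat.gcd c n = 1) (hm : 0 < m) (hn : 0 < n) (hs : s ^ m ≡ 1 [ZMOD (n : ℤ)])
    (hord : ∀ q : ℕ, q.Prime → q ∣ n → orderOf (s : ZMod q) = m) :
    ProductOneFree (Multiset.map (fun i => x m n s ^ a * y m n s ^ b i)
        (Finset.univ : Finset (Fin (m - 1))).val
      + Multiset.replicate (n - 1) (y m n s ^ c)) := by
  rw [← rot_natCast hm hn hs hord]
  refine CyclicFrobenius.productOneFree_add_replicate (a := (a : ZMod m))
    (ZMod.addOrderOf_natCast_of_gcd_eq_one hm ha) (ZMod.addOrderOf_natCast_of_gcd_eq_one hn hc)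
    ?_ ?_ (by omega)
  · simp
    omega
  · intro g hg
    obtain ⟨i, -, rfl⟩ := Multiset.mem_map.1 hg
    exact deg_x_pow_mul_y_pow hm hn hs hord a (b i)

end Metacyclic

open Metacyclic in
theorem productOneFree_iff_of_two_three {s : ℤ} (hs : s ^ 2 ≡ 1 [ZMOD ((3 : ℕ) : ℤ)])
    (hord : ∀ q : ℕ, q.Prime → q ∣ 3 → orderOf (s : ZMod q) = 2)
    (S : Multiset (Metacyclic 2 3 s)) (hS : S.card = 3) :
    ProductOneFree S ↔
      S = {x 2 3 s, x 2 3 s * y 2 3 s, x 2 3 s * y 2 3 s ^ 2} ∨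
      ∃ b c : ℕ, b ≤ 2 ∧ 1 ≤ c ∧ c ≤ 2 ∧
        S = {x 2 3 s * y 2 3 s ^ b} + Multiset.replicate 2 (y 2 3 s ^ c) := by
  set F := cyclicFrobenius two_pos three_pos hs hord with hF
  have hmap : ({x 2 3 s, x 2 3 s * y 2 3 s, x 2 3 s * y 2 3 s ^ 2} : Multiset (Metacyclic 2 3 s)) =
      Multiset.map (fun t => x 2 3 s * F.rot t) {0, 1, 2} := by
    have h0 := rot_natCast two_pos three_pos hs hord 0
    have h1 := rot_natCast two_pos three_pos hs hord 1
    have h2 := rot_natCast two_pos three_pos hs hord 2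
    rw [← hF] at h0 h1 h2
    rw [Nat.cast_zero, pow_zero] at h0
    rw [Nat.cast_one, pow_one] at h1
    rw [Nat.cast_ofNat] at h2
    simp [h0, h1, h2]
  have hone : ∀ d : ZMod 2, d ≠ 0 → d = 1 := by decide
  constructor
  · intro h
    rcases F.structure_of_extremal h (by omega) with
      ⟨a, c, R, ha, hc, hR, hRa, rfl⟩ | ⟨-, -, g, u, hg, hu, rfl⟩
    · right
      obtain ⟨g, rfl⟩ := Multiset.card_eq_one.1 (show R.card = 1 by omega)
      have ha1 : a = 1 := hone a (by
        rintro rfl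
        simp at ha)
      obtain ⟨t, rfl⟩ := eq_x_pow_mul_rot two_pos three_pos hs hord (g := g) (i := 1)
        (by simpa [ha1] using hRa g (by simp))
      have hc0 : c ≠ 0 := by
        rintro rfl
        simp at hc
      have hcv : c.val ≠ 0 := by simpa using hc0
      have h1 := ZMod.val_lt t
      have h2 := ZMod.val_lt c
      refine ⟨t.val, c.val, by omega, by omega, by omega, ?_⟩
      rw [pow_one]
      rfl
    · left
      obtain ⟨t, rfl⟩ := eq_x_pow_mul_rot two_pos three_pos hs hord (g := g) (i := 1)
        (by rw [Nat.cast_one]; exact hone _ hg)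
      -- The three reflections fill the whole nontrivial coset, so the base point and `u` disappear
      -- from the answer.
      have key : ∀ t u : ZMod 3, u ≠ 0 → ({t, t + u, t + -u} : Multiset (ZMod 3)) = {0, 1, 2} := by
        decide
      rw [hmap, ← key t u hu]
      simp [← hF, F.rot_add, mul_assoc]
  · rintro (rfl | ⟨b, c, -, hc1, hc2, rfl⟩)
    · refine CyclicFrobenius.productOneFree_of_reflections (F := F) ?_ ?_ (by simp)
      · rw [hmap]
        intro g hg
        obtain ⟨t, -, rfl⟩ := Multiset.mem_map.1 hg
        have hx := deg_x_pow_mul_y_pow two_pos three_pos hs hord 1 0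
        rw [pow_one, pow_zero, mul_one, Nat.cast_one] at hx
        rw [F.deg_mul, F.deg_rot, add_zero, hF, hx]
        decide
      · rw [hmap]
        refine Multiset.Nodup.map (fun t u h => ?_) (by decide)
        exact F.rot_injective (mul_left_cancel h)
    · have hc : Nat.gcd c 3 = 1 := by
        interval_cases c <;> rfl
      have := productOneFree_standard_form (m := 2) (n := 3) (s := s) (a := 1) (fun _ => b) rfl hc
        two_pos three_pos hs hord
      simpa using this

theorem theorem1p2 (m n : ℕ) (s : ℤ) (hm : 0 < m) (hn : 0 < n)
    (hs : s ^ m ≡ 1 [ZMOD (n : ℤ)])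
    (hord : ∀ q : ℕ, q.Prime → q ∣ n → orderOf (s : ZMod q) = m)
    (S : Multiset (Metacyclic m n s)) (hS : S.card = m + n - 2) :
    (¬ Nonempty (Metacyclic m n s ≃* Metacyclic 2 3 2) →
      (ProductOneFree S ↔
        ∃ (a c : ℕ) (b : Fin (m - 1) → ℕ), Nat.gcd a m = 1 ∧ Nat.gcd c n = 1 ∧
          S = Multiset.map
                (fun i => Metacyclic.x m n s ^ a * Metacyclic.y m n s ^ b i)
                (Finset.univ : Finset (Fin (m - 1))).val
              + Multiset.replicate (n - 1) (Metacyclic.y m n s ^ c))) ∧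
    (Nonempty (Metacyclic m n s ≃* Metacyclic 2 3 2) →
      (ProductOneFree S ↔
        S = {Metacyclic.x m n s, Metacyclic.x m n s * Metacyclic.y m n s,
              Metacyclic.x m n s * Metacyclic.y m n s ^ 2} ∨
        ∃ b c : ℕ, b ≤ 2 ∧ 1 ≤ c ∧ c ≤ 2 ∧
          S = {Metacyclic.x m n s * Metacyclic.y m n s ^ b}
              + Multiset.replicate 2 (Metacyclic.y m n s ^ c))) := by
  rw [Metacyclic.nonempty_mulEquiv_two_three_iff hm hn hs hord]
  constructor
  · intro hne
    constructor
    · intro h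
      have : NeZero m := ⟨hm.ne'⟩
      have : NeZero n := ⟨hn.ne'⟩
      rcases (Metacyclic.cyclicFrobenius hm hn hs hord).structure_of_extremal h (by omega) with
        ⟨a, c, R, ha, hc, hR, hRa, rfl⟩ | ⟨hm2, hn3, -⟩
      · exact Metacyclic.exists_standard_form hm hn hs hord ha hc hR hRa
      · exact absurd ⟨hm2, hn3⟩ hne
    · rintro ⟨a, c, b, ha, hc, rfl⟩
      exact Metacyclic.productOneFree_standard_form b ha hc hm hn hs hord
  · rintro ⟨rfl, rfl⟩
    exact productOneFree_iff_of_two_three hs hord S hS
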